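/- Monoid varieties are classes of monoids defined by sets of identities $\mathbf u\approx\mathbf v$ between words over a countably infinite alphabet. The lattice $\mathfrak L(\mathbf V)$ consists of all subvarieties of a variety $\mathbf V$, ordered by inclusion. For a word $\mathbf w$, let $M(\mathbf w)$ be the monoid consisting of all factors (contiguous subwords, including the empty word $1$) of $\mathbf w$ and a zero element $0$, where the product of two factors $\mathbf u,\mathbf v$ is $\mathbf u\mathbf v$ if this is again a factor of $\mathbf w$, and $0$ otherwise. Let $\mathbf M(\mathbf w)$ be the variety generated by $M(\mathbf w)$. For $n,m,k\in\mathbb N_0=\{0,1,2,\dots\}$ and a permutation $\tau$ of $\{1,\dots,n+m+k\}$, written on the right of its arguments, put $$ \mathbf c_{n,m,k}[\tau]=\biggl(\prod_{i=1}^n z_it_i\biggr)\,xyt\,\biggl(\prod_{i=n+1}^{n+m} z_it_i\biggr)\,x\,\biggl(\prod_{i=1}^{n+m+k} z_{i\tau}\biggr)\,y\,\biggl(\prod_{i=n+m+1}^{n+m+k} t_iz_i\biggr), $$ where $x,y,t,z_1,z_2,\dots,t_1,t_2,\dots$ are pairwise distinct letters. For $p,q\in\mathbb N_0$, let $S_{p,q}$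 be the set of all permutations $\rho$ of $\{1,\dots,p+q\}$ such that, for every $i=1,\dots,p+q-1$, exactly one of the numbers $i\rho$ and $(i+1)\rho$ is at most $p$. **Proposition.** For all $n,m\in\mathbb N_0$ and $\rho\in S_{n+m,n+m+1}$, the lattice $\mathfrak L\bigl(\mathbf M(\mathbf c_{n,m,n+m+1}[\rho])\bigr)$ is not modular, and so not distributive. -/

import Mathlib

namespace MonVar

/-- The countably infinite alphabet: three letters `x`, `y`, `t` and two sequences
`z 0, z 1, …` and `s 0, s 1, …` (the letters usually written `z_i` and `t_i`, here
indexed from `0`). -/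
inductive Letter : Type
  | x : Letter
  | y : Letter
  | t : Letter
  | z : ℕ → Letter
  | s : ℕ → Letter
  deriving DecidableEq

/-- Words: elements of the free monoid over the alphabet. -/
abbrev Word : Type := FreeMonoid Letter

/-- The monoid `M` satisfies the identity `e.1 ≈ e.2`: every substitution of elements
of `M` for letters gives both sides the same value. -/
def Satisfies (M : MonCat.{0}) (e : Word × Word) : Prop :=
  ∀ φ : Letter → M, FreeMonoid.lift φ e.1 = FreeMonoid.lift φ e.2

/-- The class of all monoids satisfying every identity in `E`. -/
def models (E : Set (Word × Word)) : Set MonCat.{0} :=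
  {M | ∀ e ∈ E, Satisfies M e}

/-- A monoid variety: a class of monoids defined by some set of identities. -/
@[ext]
structure Variety where
  carrier : Set MonCat.{0}
  equational : ∃ E : Set (Word × Word), carrier = models E

namespace Variety

/-- Varieties are ordered by inclusion. -/
instance : PartialOrder Variety :=
  PartialOrder.lift Variety.carrier fun _ _ h => Variety.ext h

/-- The infimum of a set of varieties is their intersection. -/
instance : InfSet Variety where
  sInf S :=
    { carrier := {M | ∀ V ∈ S, M ∈ V.carrier}
      equational := by
        refine ⟨{e | ∃ V ∈ S, ∀ M ∈ V.carrier, Satisfies M e}, ?_⟩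
        ext M
        constructor
        · rintro h e ⟨V, hV, he⟩
          exact he M (h V hV)
        · intro h V hV
          obtain ⟨E, hE⟩ := V.equational
          rw [hE]
          intro e he
          refine h e ⟨V, hV, fun N hN => ?_⟩
          rw [hE] at hN
          exact hN e he }

/-- The lattice of all monoid varieties: meet is intersection, and the join of a family
is the least variety containing all its members. -/
instance : CompleteLattice Variety :=
  completeLatticeOfInf Variety fun S => by
    constructor
    · intro V hV M hM
      exact hM V hV
    · intro U hU M hM V hV
      exact hU hV hM

/-- The variety generated by a monoid: the least variety containing it. -/
def generatedBy (M : MonCat.{0}) : Variety :=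
  sInf {V | M ∈ V.carrier}

/-- The lattice of subvarieties of `V`. -/
abbrev Subvarieties (V : Variety) : Type 1 := Set.Iic V

end Variety

/-- `w` is a factor (contiguous subword) of some word in `W`. The empty word is always
admitted; this is automatic as soon as `W` is nonempty. -/
def IsFactor (W : Set Word) (w : Word) : Prop :=
  w = 1 ∨ ∃ u ∈ W, ∃ a b : Word, a * w * b = u

theorem IsFactor.left {W : Set Word} {u v : Word} (h : IsFactor W (u * v)) :
    IsFactor W u := by
  rcases h with h | ⟨w, hw, a, b, rfl⟩
  · exact Or.inl (List.append_eq_nil_iff.mp h).1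
  · exact Or.inr ⟨_, hw, a, v * b, by simp only [mul_assoc]⟩

theorem IsFactor.right {W : Set Word} {u v : Word} (h : IsFactor W (u * v)) :
    IsFactor W v := by
  rcases h with h | ⟨w, hw, a, b, rfl⟩
  · exact Or.inl (List.append_eq_nil_iff.mp h).2
  · exact Or.inr ⟨_, hw, a * u, b, by simp only [mul_assoc]⟩

/-- The underlying set of the factor monoid `M(W)`: the factors of words in `W`, together
with a zero element `none`. -/
def FactorMonoid (W : Set Word) : Type := Option {w : Word // IsFactor W w}

namespace FactorMonoid

open Classical in
/-- The class of a word in `M(W)`: itself if it is a factor, and zero otherwise. -/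
noncomputable def ofWord (W : Set Word) (w : Word) : FactorMonoid W :=
  if h : IsFactor W w then some ⟨w, h⟩ else none

/-- The product of two factors is their concatenation if that is again a factor, and zero
otherwise; products with zero are zero. -/
noncomputable def mul {W : Set Word} : FactorMonoid W → FactorMonoid W → FactorMonoid W
  | some u, some v => ofWord W (u.1 * v.1)
  | some _, none => none
  | none, _ => none

theorem mul_ofWord {W : Set Word} (u : {w : Word // IsFactor W w}) (v : Word) :
    mul (some u) (ofWord W v) = ofWord W (u.1 * v) := by
  by_cases h : IsFactor W v
  · rw [show ofWord W v = some ⟨v, h⟩ from dif_pos h]; rfl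
  · rw [show ofWord W v = none from dif_neg h,
      show ofWord W (u.1 * v) = none from dif_neg fun h2 => h h2.right]; rfl

theorem ofWord_mul {W : Set Word} (u : Word) (v : {w : Word // IsFactor W w}) :
    mul (ofWord W u) (some v) = ofWord W (u * v.1) := by
  by_cases h : IsFactor W u
  · rw [show ofWord W u = some ⟨u, h⟩ from dif_pos h]; rfl
  · rw [show ofWord W u = none from dif_neg h,
      show ofWord W (u * v.1) = none from dif_neg fun h2 => h h2.left]; rfl

theorem mul_none {W : Set Word} (a : FactorMonoid W) : mul a none = none := by
  cases a <;> rfl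

noncomputable instance (W : Set Word) : Monoid (FactorMonoid W) where
  mul := mul
  one := some ⟨1, Or.inl rfl⟩
  mul_assoc := by
    intro a b c
    change mul (mul a b) c = mul a (mul b c)
    rcases a with _ | u
    · rfl
    rcases b with _ | v
    · rfl
    rcases c with _ | w
    · exact mul_none _
    · change mul (ofWord W (u.1 * v.1)) (some w) = mul (some u) (ofWord W (v.1 * w.1))
      rw [ofWord_mul, mul_ofWord, mul_assoc]
  one_mul := by
    intro a
    rcases a with _ | u
    · rfl
    · change ofWord W (1 * u.1) = some u
      rw [one_mul]
      exact dif_pos u.2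
  mul_one := by
    intro a
    rcases a with _ | u
    · rfl
    · change ofWord W (u.1 * 1) = some u
      rw [mul_one]
      exact dif_pos u.2

end FactorMonoid

/-- The variety generated by the factor monoid `M(W)`. -/
noncomputable def factorVariety (W : Set Word) : Variety :=
  Variety.generatedBy (MonCat.of (FactorMonoid W))

/-- The word `(∏_{i<n} z_i t_i) x y t (∏_{n≤i<n+m} z_i t_i) x (∏_{i<n+m+k} z_{τ(i)}) y
(∏_{n+m≤i<n+m+k} t_i z_i)`, with all products taken in increasing order of `i`.
(`List.range' a l` is the list `a, a+1, …, a+l-1`.) -/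
def cWord (n m k : ℕ) (τ : Equiv.Perm (Fin (n + m + k))) : Word :=
  FreeMonoid.ofList <|
    (List.range' 0 n).flatMap (fun i => [Letter.z i, Letter.s i]) ++
    [Letter.x, Letter.y, Letter.t] ++
    (List.range' n m).flatMap (fun i => [Letter.z i, Letter.s i]) ++
    [Letter.x] ++
    List.ofFn (fun i : Fin (n + m + k) => Letter.z (τ i)) ++
    [Letter.y] ++
    (List.range' (n + m) k).flatMap (fun i => [Letter.s i, Letter.z i])

/-- `(p,q)`-permutations: permutations `ρ` of `{0, …, p+q-1}` such that, of any two
consecutive values `ρ(i)`, `ρ(i+1)`, exactly one lies among the first `p` points. -/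
def IsAlternatingPerm (p q : ℕ) (ρ : Equiv.Perm (Fin (p + q))) : Prop :=
  ∀ i j : Fin (p + q), (j : ℕ) = i + 1 →
    ((ρ i : ℕ) < p ∧ p ≤ (ρ j : ℕ)) ∨ ((ρ j : ℕ) < p ∧ p ≤ (ρ i : ℕ))

end MonVar

/-!
A word containing two interleaved copies of `c`, with pairs `x₁`, `y₁` and `x₂`, `y₂` of letters,
gives rise to four words, according to the orders `e`, `d` in which the letters of the two pairs
first occur. Write `w e d` for them, with `xy` and `yx` for the two orders. An identity of `M(c)`
with one of these words on one side has one of them on the other side: adjacent occurrences of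
letters can be told apart by the isoterms `xsxztz` and `ztxzsx` for `c` unless both are first or
both are second occurrences. As the permutation alternates, two second occurrences are never
adjacent, and the two pairs are the only places where two first occurrences are. If the letters of
one copy are deleted, then `c` itself forbids replacing the order `xy` by `yx` in the other copy.

In the lattice of subvarieties of `V = 𝐌(c)`, let `Z` be defined by `w xy yx ≈ w yx yx`, let `X` be
defined within `Z` by `w xy xy ≈ w yx xy`, and let `Y` be defined by `w xy yx ≈ w xy xy` and
`w yx yx ≈ w yx xy`. Then `X ∨ (Y ∧ Z)` satisfies `w xy xy ≈ w yx xy`. The syntactic monoids of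
`{w xy xy, w yx xy}` and `{w xy xy, w xy yx}` lie in `X` and `Y`, so that of the intersection
`{w xy xy}` lies in `X ∨ Y`. It also lies in `Z`, but violates `w xy xy ≈ w yx xy`. That these
monoids satisfy the required identities means that no substitution maps a swap in one pair to a
swap in the other one, which is ensured by giving the two copies parts of different lengths.
-/

namespace MonVar

/-! ### Subwords -/

section Lists

variable {α β : Type*}

theorem flatMap_const_nil (l : List α) : (l.flatMap fun _ => ([] : List β)) = [] := by simp

section Restrict

variable [DecidableEq α] {k k' v w : List α}

/-- The subword of `w` formed by the occurrences of the letters in `k`. -/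
def restrict (k w : List α) : List α := w.filter (· ∈ k)

@[simp]
theorem restrict_nil (k : List α) : restrict k [] = [] := rfl

theorem restrict_cons (k : List α) (a : α) (w : List α) :
    restrict k (a :: w) = if a ∈ k then a :: restrict k w else restrict k w := by
  simp only [restrict, List.filter_cons, decide_eq_true_eq]

theorem restrict_append (k v w : List α) : restrict k (v ++ w) = restrict k v ++ restrict k w :=
  List.filter_append ..

theorem mem_restrict {a : α} : a ∈ restrict k w ↔ a ∈ w ∧ a ∈ k := by
  simp only [restrict, List.mem_filter, decide_eq_true_eq]

theorem restrict_eq_nil_iff : restrict k w = [] ↔ ∀ a ∈ k, a ∉ w := by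
  simp only [List.eq_nil_iff_forall_not_mem, mem_restrict, not_and]
  exact forall_congr' fun _ => imp_not_comm

theorem restrict_eq_self (h : w ⊆ k) : restrict k w = w :=
  List.filter_eq_self.mpr fun _ ha => decide_eq_true (h ha)

theorem restrict_congr (h : ∀ a ∈ w, a ∈ k ↔ a ∈ k') : restrict k w = restrict k' w :=
  List.filter_congr fun a ha => decide_eq_decide.mpr (h a ha)

theorem restrict_restrict_of_subset (h : k ⊆ k') : restrict k (restrict k' w) = restrict k w := by
  rw [restrict, restrict, List.filter_filter]
  exact List.filter_congr fun a _ => by simpa using @h a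

theorem count_restrict {a : α} (ha : a ∈ k) : (restrict k w).count a = w.count a :=
  List.count_filter (decide_eq_true ha)

theorem eq_of_restrict_adjacent (hperm : v.Perm w)
    (h : ∀ A p q D, w = A ++ p :: q :: D → restrict [p, q] v = restrict [p, q] w) : v = w := by
  induction w generalizing v with
  | nil => exact hperm.eq_nil
  | cons a w ih =>
    obtain _ | ⟨c, v⟩ := v
    · exact absurd hperm.symm.eq_nil (List.cons_ne_nil a w)
    obtain rfl : c = a := by
      by_contra hca
      have hc : c ∈ w := (List.mem_cons.mp (hperm.subset List.mem_cons_self)).resolve_left hca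
      obtain ⟨A, D, rfl, hcA⟩ := List.eq_append_cons_of_mem hc
      obtain ⟨A', p, hA'⟩ : ∃ A' p, a :: A = A' ++ [p] :=
        ⟨_, _, (List.dropLast_append_getLast (List.cons_ne_nil a A)).symm⟩
      have hsplit : a :: (A ++ c :: D) = A' ++ p :: c :: D := by
        rw [← List.cons_append, hA', List.append_assoc]
        rfl
      have hc' : c ∉ A' ++ [p] := hA' ▸ List.not_mem_cons_of_ne_of_not_mem hca hcA
      have hrestrict := h A' p c D hsplit
      rw [hsplit, List.append_cons, restrict_append, restrict_cons, if_pos (by simp)] at hrestrict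
      obtain ⟨b, l, hbl⟩ : ∃ b l, restrict [p, c] (A' ++ [p]) = b :: l :=
        List.exists_cons_of_ne_nil (List.ne_nil_of_mem (a := p) (mem_restrict.mpr (by simp)))
      have hb : b ∈ A' ++ [p] := (mem_restrict.mp (hbl ▸ List.mem_cons_self)).1
      rw [hbl] at hrestrict
      exact hc' ((List.cons.inj hrestrict).1 ▸ hb)
    rw [ih hperm.cons_inv fun A p q D hw => ?_]
    have := h (c :: A) p q D (by rw [hw]; rfl)
    simp only [restrict_cons] at this
    split_ifs at this
    · exact (List.cons.inj this).2
    · exact this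

end Restrict

section Merge

variable [DecidableEq α] {x y : α} {v R S : List α}

theorem exists_eq_append_of_filter_ne (hxy : x ≠ y) {A : List α} (hx : x ∉ A) (hy : y ∉ A)
    (h₁ : v.filter (· != x) = A ++ R) (h₂ : v.filter (· != y) = A ++ S) :
    ∃ v', v = A ++ v' ∧ v'.filter (· != x) = R ∧ v'.filter (· != y) = S := by
  induction A generalizing v with
  | nil => exact ⟨v, rfl, h₁, h₂⟩
  | cons a A ih =>
    simp only [List.mem_cons, not_or] at hx hy
    obtain _ | ⟨c, v⟩ := v
    · simp at h₁
    obtain rfl | hcx := eq_or_ne c x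
    · simp [hxy, hx.1] at h₂
    obtain rfl | hcy := eq_or_ne c y
    · simp [hcx, hy.1] at h₁
    simp only [List.filter_cons, bne_iff_ne, ne_eq, hcx, hcy, not_false_eq_true, if_true,
      List.cons_append, List.cons.injEq] at h₁ h₂
    obtain ⟨v', rfl, hv'⟩ := ih hx.2 hy.2 h₁.2 h₂.2
    exact ⟨v', by rw [h₁.1]; rfl, hv'⟩

theorem eq_of_filter_ne_eq (hxy : x ≠ y) {A : List α} (hx : x ∉ A) (hy : y ∉ A)
    (h₁ : v.filter (· != x) = A) (h₂ : v.filter (· != y) = A) : v = A := by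
  obtain ⟨v', rfl, h₁, h₂⟩ := exists_eq_append_of_filter_ne hxy hx hy
    (h₁.trans A.append_nil.symm) (h₂.trans A.append_nil.symm)
  suffices v' = [] by rw [this, List.append_nil]
  refine List.eq_nil_iff_forall_not_mem.mpr fun c hc => ?_
  obtain rfl | hcx := eq_or_ne c x
  · exact List.filter_eq_nil_iff.mp h₂ c hc (bne_iff_ne.mpr hxy)
  · exact List.filter_eq_nil_iff.mp h₁ c hc (bne_iff_ne.mpr hcx)

theorem exists_eq_cons_of_filter_ne (hxy : x ≠ y) (hR : R.head? ≠ some y)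
    (h₁ : v.filter (· != x) = R) (h₂ : v.filter (· != y) = x :: S) :
    ∃ v', v = x :: v' ∧ v'.filter (· != x) = R ∧ v'.filter (· != y) = S := by
  subst h₁
  obtain _ | ⟨c, v⟩ := v
  · simp at h₂
  obtain rfl | hcx := eq_or_ne c x
  · simp only [List.filter_cons, bne_iff_ne, ne_eq, hxy, not_false_eq_true, if_true,
      List.cons.injEq, true_and] at h₂
    exact ⟨v, rfl, by simp, h₂⟩
  obtain rfl | hcy := eq_or_ne c y
  · simp [hcx] at hR
  · simp [hcx, hcy] at h₂

theorem exists_eq_cons_or_of_filter_ne (hxy : x ≠ y)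
    (h₁ : v.filter (· != x) = y :: R) (h₂ : v.filter (· != y) = x :: S) :
    ∃ v', v = x :: v' ∧ v'.filter (· != x) = y :: R ∧ v'.filter (· != y) = S ∨
      v = y :: v' ∧ v'.filter (· != x) = R ∧ v'.filter (· != y) = x :: S := by
  obtain _ | ⟨c, v⟩ := v
  · simp at h₁
  obtain rfl | hcx := eq_or_ne c x
  · exact ⟨v, .inl ⟨rfl, by simpa using h₁, by simpa [hxy] using h₂⟩⟩
  obtain rfl | hcy := eq_or_ne c y
  · exact ⟨v, .inr ⟨rfl, by simpa [hcx] using h₁, by simpa using h₂⟩⟩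
  · simp [hcx, hcy] at h₁

variable {A C E D : List α}

theorem eq_append_of_filter_ne (hxy : x ≠ y) (hE : E ≠ [])
    (hx : x ∉ C ++ E ++ D) (hy : y ∉ C ++ E ++ D)
    (h₁ : v.filter (· != x) = C ++ (E ++ y :: D)) (h₂ : v.filter (· != y) = C ++ x :: (E ++ D)) :
    v = C ++ x :: (E ++ y :: D) := by
  simp only [List.mem_append, not_or] at hx hy
  obtain ⟨v, rfl, h₁, h₂⟩ := exists_eq_append_of_filter_ne hxy hx.1.1 hy.1.1 h₁ h₂
  obtain ⟨v, rfl, h₁, h₂⟩ := exists_eq_cons_of_filter_ne hxy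
    (fun h => hy.1.2 (List.mem_of_mem_head? (List.head?_append_of_ne_nil E hE ▸ h))) h₁ h₂
  obtain ⟨v, rfl, h₁, h₂⟩ := exists_eq_append_of_filter_ne hxy hx.1.2 hy.1.2 h₁ h₂
  obtain ⟨v, rfl, h₂, h₁⟩ := exists_eq_cons_of_filter_ne hxy.symm
    (fun h => hx.2 (List.mem_of_mem_head? h)) h₂ h₁
  rw [eq_of_filter_ne_eq hxy hx.2 hy.2 h₁ h₂]

theorem eq_or_eq_of_filter_ne (hxy : x ≠ y) (hC : C ≠ []) (hE : E ≠ [])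
    (hx : x ∉ A ++ (C ++ E ++ D)) (hy : y ∉ A ++ (C ++ E ++ D))
    (h₁ : v.filter (· != x) = A ++ y :: (C ++ (E ++ y :: D)))
    (h₂ : v.filter (· != y) = A ++ x :: (C ++ x :: (E ++ D))) :
    v = A ++ x :: y :: (C ++ x :: (E ++ y :: D)) ∨
      v = A ++ y :: x :: (C ++ x :: (E ++ y :: D)) := by
  rw [List.mem_append, not_or] at hx hy
  have hhead {a : α} {F : List α} (ha : a ∉ C ++ E ++ D) : (C ++ F).head? ≠ some a := by
    rw [List.head?_append_of_ne_nil _ hC]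
    exact fun h => ha (by simp [List.mem_of_mem_head? h])
  obtain ⟨v, rfl, h₁, h₂⟩ := exists_eq_append_of_filter_ne hxy hx.1 hy.1 h₁ h₂
  obtain ⟨v, ⟨rfl, h₁, h₂⟩ | ⟨rfl, h₁, h₂⟩⟩ := exists_eq_cons_or_of_filter_ne hxy h₁ h₂
  · obtain ⟨v, rfl, h₂, h₁⟩ := exists_eq_cons_of_filter_ne hxy.symm (hhead hx.2) h₂ h₁
    rw [eq_append_of_filter_ne hxy hE hx.2 hy.2 h₁ h₂]
    exact .inl rfl
  · obtain ⟨v, rfl, h₁, h₂⟩ := exists_eq_cons_of_filter_ne hxy (hhead hy.2) h₁ h₂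
    rw [eq_append_of_filter_ne hxy hE hx.2 hy.2 h₁ h₂]
    exact .inr rfl

end Merge

end Lists

/-! ### Isoterms -/

section Tests

variable {α β γ : Type*}

/-- The identity `u ≈ v` passes, from left to right, every test by a substitution into factors
of the word `c`: it is what `M(c) ⊨ u ≈ v` says about the substitutions under which `u` has a
nonzero value. -/
def FactorEq (c : List α) (u v : List β) : Prop :=
  ∀ φ : β → List α, u.flatMap φ <:+: c → v.flatMap φ = u.flatMap φ

/-- The word `w` is an isoterm for `c`: no other word passes the tests that `c` imposes on `w`. -/
def Isoterm (c : List α) (w : List β) : Prop :=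
  ∀ v, FactorEq c w v → v = w

variable {c : List α} {u v : List β}

theorem filter_eq_flatMap (S : β → Bool) (w : List β) :
    w.filter S = w.flatMap fun b => if S b then [b] else [] := by
  induction w with
  | nil => rfl
  | cons b w ih => rw [List.filter_cons, List.flatMap_cons, ← ih]; split_ifs <;> rfl

theorem FactorEq.flatMap (h : FactorEq c u v) (ψ : β → List γ) :
    FactorEq c (u.flatMap ψ) (v.flatMap ψ) := by
  intro φ hφ
  rw [List.flatMap_assoc] at hφ ⊢
  rw [List.flatMap_assoc]
  exact h _ hφ

theorem FactorEq.filter (h : FactorEq c u v) (S : β → Bool) :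
    FactorEq c (u.filter S) (v.filter S) := by
  rw [filter_eq_flatMap, filter_eq_flatMap]
  exact h.flatMap _

theorem FactorEq.append (h : FactorEq c u v) (a b : List β) :
    FactorEq c (a ++ u ++ b) (a ++ v ++ b) := by
  intro φ hφ
  simp only [List.flatMap_append] at hφ ⊢
  rw [h φ (List.IsInfix.trans ⟨a.flatMap φ, b.flatMap φ, rfl⟩ hφ)]

theorem FactorEq.of_isoterm {w : List γ} (h : FactorEq c u v) (hw : Isoterm c w) :
    FactorEq w u v := by
  rintro φ ⟨a, b, hab⟩
  have hv := hw _ (hab ▸ (h.flatMap φ).append a b)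
  exact List.append_cancel_left (List.append_cancel_right (hv.trans hab.symm))

theorem isoterm_of_leftInverse {w : List β} (hw₀ : w ≠ []) (φ : β → List α) (ψ : α → List β)
    (hψ : ∀ b ∈ w, (φ b).flatMap ψ = [b]) (hw : w.flatMap φ <:+: c) : Isoterm c w := by
  classical
  intro v hv
  have hinv (L : List α) : v.flatMap (fun b => if b ∈ w then [b] else L.flatMap ψ) = w := by
    have hwφ : w.flatMap (fun b => if b ∈ w then φ b else L) = w.flatMap φ :=
      List.flatMap_congr fun b hb => if_pos hb
    calc v.flatMap (fun b => if b ∈ w then [b] else L.flatMap ψ)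
      _ = (v.flatMap fun b => if b ∈ w then φ b else L).flatMap ψ := by
        rw [List.flatMap_assoc]
        refine List.flatMap_congr fun b _ => ?_
        split_ifs with hb
        exacts [(hψ b hb).symm, rfl]
      _ = (w.flatMap φ).flatMap ψ := by rw [hv _ (hwφ ▸ hw), hwφ]
      _ = w := by rw [List.flatMap_assoc, List.flatMap_congr hψ, List.flatMap_singleton']
  have hfilter : v.filter (· ∈ w) = w := by
    rw [filter_eq_flatMap]
    simpa only [decide_eq_true_eq, List.flatMap_nil] using hinv []
  obtain ⟨b, hb⟩ := List.exists_mem_of_ne_nil w hw₀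
  have hlength : w.length = v.length := by
    conv_lhs => rw [← hinv (φ b), hψ b hb, List.length_flatMap]
    simp [apply_ite]
  exact ((hfilter ▸ List.filter_sublist : w.Sublist v).eq_of_length hlength).symm

variable [DecidableEq β]

theorem FactorEq.restrict_eq {w : List ℕ} (h : FactorEq w u v) (k : List β)
    (hu : (restrict k u).map k.idxOf <:+: w) : restrict k v = restrict k u := by
  have hflat (l : List β) :
      (l.flatMap fun b => if b ∈ k then [k.idxOf b] else []) = (restrict k l).map k.idxOf := by
    induction l with
    | nil => rfl
    | cons b l ih => rw [List.flatMap_cons, ih, restrict_cons]; split_ifs <;> rfl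
  have hidx (l : List β) :
      ((restrict k l).map k.idxOf).map (k[·]?) = (restrict k l).map some := by
    rw [List.map_map]
    exact List.map_congr_left fun b hb => List.getElem?_idxOf (mem_restrict.mp hb).2
  have heq := h (fun b => if b ∈ k then [k.idxOf b] else []) (by rwa [hflat])
  rw [hflat, hflat] at heq
  exact List.map_injective_iff.mpr (Option.some_injective β) (by rw [← hidx, heq, hidx])

end Tests

section Marked

variable {α β : Type*}

/-- The status of an occurrence of a letter in a word in which no letter occurs more than
twice: the only occurrence, the first one, or the second one. -/
inductive Kind : Type
  | lin : Kind
  | fst : Kind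
  | snd : Kind
  deriving DecidableEq

/-- The isoterms by which the order of two adjacent occurrences can be tested, unless both are
first or both are second occurrences: `xsxztz` and `ztxzsx` with `x`, `s`, `z`, `t` encoded as `0`,
`1`, `2`, `3`. The fields are named after the two occurrences in the middle. -/
structure Detects (c : List α) : Prop where
  snd_fst : Isoterm c [0, 1, 0, 2, 3, 2]
  fst_snd : Isoterm c [2, 3, 0, 2, 1, 0]

variable [DecidableEq β]

/-- In the marked word `W` every letter belongs to a pair of letters that form the subword
`p ℓ p`, and the marks are correct. -/
def Paired (W : List (β × Kind)) : Prop :=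
  ∀ a ∈ W, ∃ p l, p ≠ l ∧ a.1 ∈ [p, l] ∧
    W.filter (·.1 ∈ [p, l]) = [(p, .fst), (l, .lin), (p, .snd)]

/-- The ways in which a letter `p` of a paired word with the given mark can sit between the prefix
`A` and the suffix `D`. -/
inductive Occurs (A D : List β) (p : β) : Kind → Prop
  | lin : p ∉ A → p ∉ D → Occurs A D p .lin
  | fst (l : β) : p ≠ l → p ∉ A → l ∉ A → restrict [p, l] D = [l, p] → Occurs A D p .fst
  | snd (l : β) : p ≠ l → p ∉ D → l ∉ D → restrict [p, l] A = [p, l] → Occurs A D p .snd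

theorem restrict_map_fst (k : List β) (A : List (β × Kind)) :
    restrict k (A.map Prod.fst) = (A.filter (·.1 ∈ k)).map Prod.fst :=
  List.filter_map

theorem Paired.occurs {W A D : List (β × Kind)} {p : β} {i : Kind} (hW : Paired W)
    (h : W = A ++ (p, i) :: D) : Occurs (A.map Prod.fst) (D.map Prod.fst) p i := by
  obtain ⟨p₀, l₀, hne, hp, hf⟩ := hW (p, i) (h ▸ List.mem_append_right A List.mem_cons_self)
  rw [h, List.filter_append, List.filter_cons_of_pos (by simpa using hp)] at hf
  have hA := restrict_map_fst [p₀, l₀] A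
  have hD := restrict_map_fst [p₀, l₀] D
  rcases hA' : A.filter (·.1 ∈ [p₀, l₀]) with _ | ⟨a, _ | ⟨b, _ | ⟨c, L⟩⟩⟩ <;>
    rw [hA'] at hA hf <;>
    simp only [List.nil_append, List.cons_append, List.cons.injEq, Prod.mk.injEq, List.map_nil,
      List.map_cons] at hf hA
  · obtain ⟨⟨rfl, rfl⟩, hD'⟩ := hf
    rw [hD'] at hD
    have := restrict_eq_nil_iff.mp hA
    exact .fst l₀ hne (this p (by simp)) (this l₀ (by simp)) hD
  · obtain ⟨rfl, ⟨rfl, rfl⟩, hD'⟩ := hf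
    rw [hD'] at hD
    have hmem {F : List β} (hF : restrict [p₀, p] F = [p₀]) : p ∉ F := fun hp =>
      hne (by simpa [hF, eq_comm] using mem_restrict.mpr ⟨hp, (by simp : p ∈ [p₀, p])⟩)
    exact .lin (hmem hA) (hmem hD)
  · obtain ⟨rfl, rfl, ⟨rfl, rfl⟩, hD'⟩ := hf
    rw [hD'] at hD
    have := restrict_eq_nil_iff.mp hD
    exact .snd l₀ hne (this p (by simp)) (this l₀ (by simp)) hA
  · simp at hf

theorem FactorEq.restrict_pair_eq {w : List ℕ} {A D a d v k : List β} {p q : β}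
    (h : FactorEq w (A ++ p :: q :: D) v) (hp : p ∈ k) (hq : q ∈ k) (hA : restrict k A = a)
    (hD : restrict k D = d) (hw : (a ++ p :: q :: d).map k.idxOf <:+: w) :
    restrict [p, q] v = restrict [p, q] (A ++ p :: q :: D) := by
  have hu : restrict k (A ++ p :: q :: D) = a ++ p :: q :: d := by
    rw [restrict_append, restrict_cons, restrict_cons, if_pos hp, if_pos hq, hA, hD]
  have hk : [p, q] ⊆ k := by simp [hp, hq]
  rw [← restrict_restrict_of_subset hk, h.restrict_eq k (hu ▸ hw), restrict_restrict_of_subset hk]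

theorem restrict_eq_of_subset {k k' A L : List β} (hsub : k' ⊆ k)
    (hA : ∀ a ∈ k, a ∈ k' ∨ a ∉ A) (h : restrict k' A = L) : restrict k A = L := by
  rw [← h]
  exact restrict_congr fun a ha =>
    ⟨fun hk => (hA a hk).resolve_right (not_not_intro ha), fun hk => hsub hk⟩

theorem FactorEq.restrict_pair_eq_of_fst_snd {A D v : List β} {p q l r : β}
    (h : FactorEq [2, 3, 0, 2, 1, 0] (A ++ p :: q :: D) v)
    (hpl : p ≠ l) (hpA : p ∉ A) (hlA : l ∉ A) (hlD : restrict [p, l] (q :: D) = [l, p])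
    (hqr : q ≠ r) (hqD : q ∉ D) (hrD : r ∉ D) (hrA : restrict [q, r] (A ++ [p]) = [q, r]) :
    restrict [p, q] v = restrict [p, q] (A ++ p :: q :: D) := by
  have hqA' : q ∈ A ++ [p] := by grind [mem_restrict (k := [q, r]) (w := A ++ [p]) (a := q)]
  have hlD' : l ∈ q :: D := by grind [mem_restrict (k := [p, l]) (w := q :: D) (a := l)]
  have hpD : p ∈ q :: D := by grind [mem_restrict (k := [p, l]) (w := q :: D) (a := p)]
  have hpq : p ≠ q := by grind [restrict_cons]
  refine h.restrict_pair_eq (k := [p, l, q, r]) (a := [q, r]) (d := [l, p]) (by simp) (by simp)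
    ?_ ?_ ?_
  · refine restrict_eq_of_subset (k' := [q, r]) (by grind) (by grind) ?_
    grind [restrict_append, restrict_cons, restrict_nil]
  · refine restrict_eq_of_subset (k' := [p, l]) (by grind) (by grind) ?_
    grind [restrict_cons]
  · exact ⟨[], [], by grind⟩

theorem Occurs.restrict_pair_eq_of_lin {A D v : List β} {p q : β} {j : Kind}
    (h : FactorEq [0, 1, 0, 2, 3, 2] (A ++ p :: q :: D) v) (hpA : p ∉ A) (hpD : p ∉ q :: D)
    (hq : Occurs (A ++ [p]) D q j) : restrict [p, q] v = restrict [p, q] (A ++ p :: q :: D) := by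
  have hpq : p ≠ q := by grind
  rcases hq with ⟨hqA, hqD⟩ | ⟨r, hqr, hqA, hrA, hrD⟩ | ⟨r, hqr, hqD, hrD, hrA⟩
  · refine h.restrict_pair_eq (k := [p, q]) (a := []) (d := []) (by simp) (by simp) ?_ ?_ ?_
    · grind [restrict_eq_nil_iff]
    · grind [restrict_eq_nil_iff]
    · exact ⟨[], [0, 2, 3, 2], by grind⟩
  · -- Repeating `p` in the list moves `q` and `r` to the indices `2` and `3`.
    refine h.restrict_pair_eq (k := [p, p, q, r]) (a := []) (d := [r, q]) (by simp) (by simp)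
      ?_ ?_ ?_
    · grind [restrict_eq_nil_iff]
    · exact restrict_eq_of_subset (by grind) (by grind) hrD
    · exact ⟨[0, 1], [], by grind⟩
  · refine h.restrict_pair_eq (k := [q, p]) (a := [q]) (d := []) (by simp) (by simp) ?_ ?_ ?_
    · refine restrict_eq_of_subset (k' := [q]) (by grind) (by grind) ?_
      grind [restrict_append, restrict_cons, restrict_nil,
        restrict_restrict_of_subset (k := [q]) (k' := [q, r]) (w := A ++ [p]) (by simp)]
    · grind [restrict_eq_nil_iff]
    · exact ⟨[], [2, 3, 2], by grind⟩

theorem Occurs.restrict_pair_eq_of_snd {A D v : List β} {p q l : β} {j : Kind}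
    (h : FactorEq [0, 1, 0, 2, 3, 2] (A ++ p :: q :: D) v) (hpl : p ≠ l) (hpD : p ∉ q :: D)
    (hlD : l ∉ q :: D) (hlA : restrict [p, l] A = [p, l]) (hq : Occurs (A ++ [p]) D q j)
    (hj : j ≠ .snd) : restrict [p, q] v = restrict [p, q] (A ++ p :: q :: D) := by
  rcases hq with ⟨hqA, hqD⟩ | ⟨r, hqr, hqA, hrA, hrD⟩ | ⟨r, hqr, hqD, hrD, hrA⟩
  · refine h.restrict_pair_eq (k := [p, l, q]) (a := [p, l]) (d := []) (by simp) (by simp)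
      ?_ ?_ ?_
    · exact restrict_eq_of_subset (by grind) (by grind) hlA
    · grind [restrict_eq_nil_iff]
    · exact ⟨[], [3, 2], by grind⟩
  · have hlA' : l ∈ A := by grind [mem_restrict (k := [p, l]) (w := A) (a := l)]
    refine h.restrict_pair_eq (k := [p, l, q, r]) (a := [p, l]) (d := [r, q]) (by simp) (by simp)
      ?_ ?_ ?_
    · exact restrict_eq_of_subset (by grind) (by grind) hlA
    · exact restrict_eq_of_subset (by grind) (by grind) hrD
    · exact ⟨[], [], by grind⟩
  · exact absurd rfl hj

theorem Occurs.restrict_pair_eq {c : List α} {A D v : List β} {p q : β} {i j : Kind}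
    (hc : Detects c) (h : FactorEq c (A ++ p :: q :: D) v)
    (hp : Occurs A (q :: D) p i) (hq : Occurs (A ++ [p]) D q j)
    (hff : i = .fst → j ≠ .fst) (hss : i = .snd → j ≠ .snd) :
    restrict [p, q] v = restrict [p, q] (A ++ p :: q :: D) := by
  have hsf := h.of_isoterm hc.snd_fst
  rcases hp with ⟨hpA, hpD⟩ | ⟨l, hpl, hpA, hlA, hlD⟩ | ⟨l, hpl, hpD, hlD, hlA⟩
  · exact hq.restrict_pair_eq_of_lin hsf hpA hpD
  · rcases hq with ⟨hqA, hqD⟩ | _ | ⟨r, hqr, hqD, hrD, hrA⟩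
    · refine hsf.restrict_pair_eq (k := [p, q]) (a := []) (d := [p]) (by simp) (by simp) ?_ ?_ ?_
      · grind [restrict_eq_nil_iff]
      · refine restrict_eq_of_subset (k' := [p]) (by grind) (by grind) ?_
        grind [restrict_cons, restrict_nil,
          restrict_restrict_of_subset (k := [p]) (k' := [p, l]) (w := q :: D) (by simp)]
      · have : p ≠ q := by grind
        exact ⟨[], [2, 3, 2], by grind⟩
    · exact absurd rfl (hff rfl)
    · exact (h.of_isoterm hc.fst_snd).restrict_pair_eq_of_fst_snd hpl hpA hlA hlD hqr hqD hrD hrA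
  · exact hq.restrict_pair_eq_of_snd hsf hpl hpD hlD hlA (hss rfl)

variable {c : List α} {v : List β} {W : List (β × Kind)}

theorem FactorEq.perm (hc : Detects c) (hW : Paired W) (h : FactorEq c (W.map Prod.fst) v) :
    v.Perm (W.map Prod.fst) := by
  have h := h.of_isoterm hc.snd_fst
  refine List.perm_iff_count.mpr fun a => ?_
  by_cases ha : a ∈ W.map Prod.fst
  · obtain ⟨b, hb, rfl⟩ := List.mem_map.mp ha
    obtain ⟨p, l, hpl, hb', hf⟩ := hW b hb
    have hv := h.restrict_eq [p, l] ⟨[], [2, 3, 2], by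
      rw [restrict_map_fst, hf]
      simp [List.idxOf_cons, beq_eq_false_iff_ne.mpr hpl]⟩
    rw [← count_restrict hb', hv, count_restrict hb']
  · have hu : restrict [a] (W.map Prod.fst) = [] := restrict_eq_nil_iff.mpr (by simpa using ha)
    have hv := h.restrict_eq [a] (by rw [hu]; exact List.nil_infix)
    have hav : a ∉ v := restrict_eq_nil_iff.mp (hv.trans hu) a (List.mem_singleton_self a)
    rw [List.count_eq_zero_of_not_mem hav, List.count_eq_zero_of_not_mem ha]

theorem FactorEq.eq (hc : Detects c) (hW : Paired W)
    (hchain : W.IsChain fun a b => (a.2 = .fst → b.2 ≠ .fst) ∧ (a.2 = .snd → b.2 ≠ .snd))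
    (h : FactorEq c (W.map Prod.fst) v) : v = W.map Prod.fst := by
  refine eq_of_restrict_adjacent (h.perm hc hW) fun A p q D hs => ?_
  obtain ⟨A, R, rfl, rfl, hR⟩ := List.map_eq_append_iff.mp hs
  obtain ⟨⟨p, i⟩, R, rfl, rfl, hR'⟩ := List.map_eq_cons_iff.mp hR
  obtain ⟨⟨q, j⟩, D, rfl, rfl, rfl⟩ := List.map_eq_cons_iff.mp hR'
  have hij := (List.isChain_append_cons_cons.mp hchain).2.1
  have hq := hW.occurs (List.append_cons A (p, i) ((q, j) :: D))
  rw [List.map_append] at hq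
  rw [hs] at h ⊢
  exact (hW.occurs rfl).restrict_pair_eq hc h hq hij.1 hij.2

end Marked

/-! ### Words made of two copies of the scheme -/

section Words

/-- The letters of the words used to separate subvarieties: two copies of the letters `x`, `y`, `t`
of `cWord` and letters `z i`, `s i` (written `z_i`, `t_i` in `cWord`) for `i` in an arbitrary type
of indices. -/
inductive TwinLetter (ι : Type*) : Type _
  | x₁ : TwinLetter ι
  | y₁ : TwinLetter ι
  | t₁ : TwinLetter ι
  | x₂ : TwinLetter ι
  | y₂ : TwinLetter ι
  | t₂ : TwinLetter ι
  | z : ι → TwinLetter ι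
  | s : ι → TwinLetter ι
  deriving DecidableEq, Countable

open TwinLetter Kind

variable {ι : Type*} {A D M : List ι} {i : ι} {k : Kind} {e : List (TwinLetter ι)}

/-- The word `∏ z_i s_i` over the indices in the list, marked as first occurrences of the `z_i`. -/
def pre (A : List ι) : List (TwinLetter ι × Kind) :=
  A.flatMap fun i => [(z i, fst), (s i, lin)]

/-- The word `∏ s_i z_i` over the indices in the list, marked as second occurrences of the `z_i`. -/
def post (D : List ι) : List (TwinLetter ι × Kind) :=
  D.flatMap fun i => [(s i, lin), (z i, snd)]

/-- Marks all letters of a word in the same way. -/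
def mark (k : Kind) (e : List (TwinLetter ι)) : List (TwinLetter ι × Kind) := e.map (·, k)

theorem exists_of_mem_pre {a : TwinLetter ι × Kind} (ha : a ∈ pre A) :
    ∃ i ∈ A, a.1 ∈ [z i, s i] := by
  grind [pre]

theorem exists_of_mem_post {a : TwinLetter ι × Kind} (ha : a ∈ post D) :
    ∃ i ∈ D, a.1 ∈ [z i, s i] := by
  grind [post]

theorem fst_mem_of_mem_mark {a : TwinLetter ι × Kind} (ha : a ∈ mark k e) : a.1 ∈ e := by
  grind [mark]

theorem map_mark : (mark k e).map Prod.fst = e := by simp [mark, Function.comp_def]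

theorem z_mem_map_pre : z i ∈ (pre A).map Prod.fst ↔ i ∈ A := by simp [pre]

theorem z_mem_map_post : z i ∈ (post D).map Prod.fst ↔ i ∈ D := by simp [post]

variable [DecidableEq ι]

/-- The word `∏ z_i` over the indices in `M`, in which the letters with indices in `D` occur for
the first time and the others for the second time. -/
def mid (D M : List ι) : List (TwinLetter ι × Kind) :=
  M.map fun i => (z i, if i ∈ D then fst else snd)

theorem z_mem_map_mid : z i ∈ (mid D M).map Prod.fst ↔ i ∈ M := by simp [mid]

theorem exists_of_mem_mid {a : TwinLetter ι × Kind} (ha : a ∈ mid D M) :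
    ∃ i ∈ M, a.1 ∈ [z i, s i] := by
  grind [mid]

theorem filter_pre_pair (hA : A.Nodup) (i : ι) :
    (pre A).filter (·.1 ∈ [z i, s i]) = if i ∈ A then [(z i, fst), (s i, lin)] else [] := by
  induction A with
  | nil => rfl
  | cons j A ih =>
    rw [List.nodup_cons] at hA
    specialize ih hA.2
    rw [pre, List.flatMap_cons, List.filter_append, ← pre, ih]
    grind

theorem filter_post_pair (hD : D.Nodup) (i : ι) :
    (post D).filter (·.1 ∈ [z i, s i]) = if i ∈ D then [(s i, lin), (z i, snd)] else [] := by
  induction D with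
  | nil => rfl
  | cons j D ih =>
    rw [List.nodup_cons] at hD
    specialize ih hD.2
    rw [post, List.flatMap_cons, List.filter_append, ← post, ih]
    grind

theorem filter_mid_pair (hM : M.Nodup) (D : List ι) (i : ι) :
    (mid D M).filter (·.1 ∈ [z i, s i]) =
      if i ∈ M then [(z i, if i ∈ D then fst else snd)] else [] := by
  induction M with
  | nil => rfl
  | cons j M ih =>
    rw [List.nodup_cons] at hM
    specialize ih hM.2
    rw [mid, List.map_cons, List.filter_cons, ← mid, ih]
    grind

theorem filter_mark_pair (he : e.Nodup) (p l : TwinLetter ι) (hl : l ∉ e) :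
    (mark k e).filter (·.1 ∈ [p, l]) = if p ∈ e then [(p, k)] else [] := by
  induction e with
  | nil => rfl
  | cons q e ih =>
    rw [List.nodup_cons] at he
    specialize ih he.2 (by grind)
    rw [mark, List.map_cons, List.filter_cons, ← mark, ih]
    grind

theorem filter_eq_nil_of_forall_ne {W : List (TwinLetter ι × Kind)} {p l : TwinLetter ι}
    (h : ∀ a ∈ W, a.1 ≠ p ∧ a.1 ≠ l) : W.filter (·.1 ∈ [p, l]) = [] := by
  simpa [List.filter_eq_nil_iff, Prod.forall] using h

end Words

section Layout

open TwinLetter Kind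

/-- Two interleaved copies of the scheme of `cWord`. The lists `A`, `C`, `D` contain the indices
`i` whose letter `z i` occurs outside of the list `M` before the first `xy`, between the first `xy`
and the second `x`, and after the second `y`, respectively. -/
structure Layout (ι : Type*) where
  (A₁ C₁ D₁ M₁ A₂ C₂ D₂ M₂ : List ι)
  perm₁ : M₁.Perm (A₁ ++ C₁ ++ D₁)
  perm₂ : M₂.Perm (A₂ ++ C₂ ++ D₂)
  nodup : (M₁ ++ M₂).Nodup
  isChain₁ : M₁.IsChain fun i j => i ∈ D₁ ↔ j ∉ D₁
  isChain₂ : M₂.IsChain fun i j => i ∈ D₂ ↔ j ∉ D₂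
  head₁ : ∃ i ∈ M₁.head?, i ∉ D₁
  head₂ : ∃ i ∈ M₂.head?, i ∈ D₂
  last₁ : ∃ i ∈ M₁.getLast?, i ∈ D₁
  last₂ : ∃ i ∈ M₂.getLast?, i ∈ D₂
  length_A : A₂.length < A₁.length
  length_C : C₁.length < C₂.length

/-- A nonempty word without repetitions in the letters of `k`, hence, for a pair of letters,
one of the two orders of the pair or one of the letters. -/
structure IsOrder {β : Type*} (k e : List β) : Prop where
  nodup : e.Nodup
  ne_nil : e ≠ []
  subset : e ⊆ k

variable {ι : Type*} [DecidableEq ι]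

namespace Layout

variable (K : Layout ι) {e d : List (TwinLetter ι)} {i : ι}

/-- The word in which `e` and `d` are the first occurrences of `x₁`, `y₁` and of `x₂`, `y₂`; it
becomes the word of the first (second) copy if the letters of the other copy are deleted. A letter
missing from `e` or `d` is also missing from the rest of the word. -/
def marked (e d : List (TwinLetter ι)) : List (TwinLetter ι × Kind) :=
  pre K.A₁ ++ (pre K.A₂ ++ (mark fst e ++ (t₁, lin) :: (pre K.C₁ ++ (mark snd (restrict [x₁] e) ++
    (mark fst d ++ (mid K.D₁ K.M₁ ++ (mark snd (restrict [y₁] e) ++ (post K.D₁ ++ (t₂, lin) ::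
      (pre K.C₂ ++ (mark snd (restrict [x₂] d) ++ (mid K.D₂ K.M₂ ++ (mark snd (restrict [y₂] d) ++
        post K.D₂))))))))))))

/-- The word `marked` without its marks. -/
def word (e d : List (TwinLetter ι)) : List (TwinLetter ι) := (K.marked e d).map Prod.fst

variable {K}

theorem filter_marked_z (he : e ⊆ [x₁, y₁]) (hd : d ⊆ [x₂, y₂])
    (hi : i ∈ K.M₁ ∨ i ∈ K.M₂) :
    (K.marked e d).filter (·.1 ∈ [z i, s i]) = [(z i, fst), (s i, lin), (z i, snd)] := by
  have hM := K.nodup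
  have hA₁ := K.perm₁.nodup_iff.mp hM.of_append_left
  have hA₂ := K.perm₂.nodup_iff.mp hM.of_append_right
  have hm₁ := K.perm₁.mem_iff (a := i)
  have hm₂ := K.perm₂.mem_iff (a := i)
  have hmark (k) (f : List (TwinLetter ι)) (hf : z i ∉ f ∧ s i ∉ f) :
      (mark k f).filter (·.1 ∈ [z i, s i]) = [] := by
    simp only [mark, List.filter_eq_nil_iff]
    grind
  have hze : z i ∉ e ∧ s i ∉ e := by grind
  have hzd : z i ∉ d ∧ s i ∉ d := by grind
  have hr (k f : List (TwinLetter ι)) (hf : z i ∉ f ∧ s i ∉ f) :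
      z i ∉ restrict k f ∧ s i ∉ restrict k f := by grind [mem_restrict]
  simp only [List.nodup_append, List.mem_append] at hA₁ hA₂ hM hm₁ hm₂
  simp only [marked, List.filter_append, List.filter_cons, hmark _ _ hze, hmark _ _ hzd,
    hmark _ _ (hr _ _ hze), hmark _ _ (hr _ _ hzd), filter_pre_pair hA₁.1.1,
    filter_pre_pair hA₁.1.2.1, filter_post_pair hA₁.2.1, filter_pre_pair hA₂.1.1,
    filter_pre_pair hA₂.1.2.1, filter_post_pair hA₂.2.1, filter_mid_pair hM.1,
    filter_mid_pair hM.2.1]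
  simp only [List.mem_cons, List.not_mem_nil, reduceCtorEq, or_self, decide_false,
    Bool.false_eq_true, if_false, List.nil_append]
  clear hmark hze hzd hr he hd
  grind

theorem filter_marked_t {p l : TwinLetter ι} (he : IsOrder [x₁, y₁] e) (hd : IsOrder [x₂, y₂] d)
    (hp : p ∈ e ∧ l = t₁ ∨ p ∈ d ∧ l = t₂) :
    (K.marked e d).filter (·.1 ∈ [p, l]) = [(p, fst), (l, lin), (p, snd)] := by
  have hpl : (p = x₁ ∨ p = y₁) ∧ l = t₁ ∨ (p = x₂ ∨ p = y₂) ∧ l = t₂ := by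
    simpa using hp.imp (And.imp_left fun h => he.subset h) (And.imp_left fun h => hd.subset h)
  have hpre (A : List ι) : (pre A).filter (·.1 ∈ [p, l]) = [] :=
    filter_eq_nil_of_forall_ne (by grind [pre])
  have hpost (A : List ι) : (post A).filter (·.1 ∈ [p, l]) = [] :=
    filter_eq_nil_of_forall_ne (by grind [post])
  have hmid (D M : List ι) : (mid D M).filter (·.1 ∈ [p, l]) = [] :=
    filter_eq_nil_of_forall_ne (by grind [mid])
  have hmark (k) {f} (hf : f.Sublist e ∨ f.Sublist d) :
      (mark k f).filter (·.1 ∈ [p, l]) = if p ∈ f then [(p, k)] else [] :=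
    filter_mark_pair (hf.elim (·.nodup he.nodup) (·.nodup hd.nodup)) _ _ fun h => by
      have := hf.imp (fun hf => he.subset (hf.subset h)) (fun hf => hd.subset (hf.subset h))
      grind
  simp only [marked, List.filter_append, List.filter_cons, hpre, hpost, hmid,
    hmark _ (.inl (.refl e)), hmark _ (.inl (List.filter_sublist (l := e))),
    hmark _ (.inr (.refl d)), hmark _ (.inr (List.filter_sublist (l := d))), restrict,
    List.mem_filter]
  have hde : p ∈ e → p ∉ d := by grind [he.subset, hd.subset]
  rcases hp with ⟨hp, rfl⟩ | ⟨hp, rfl⟩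
  · rcases hpl with ⟨rfl | rfl, -⟩ | ⟨-, h⟩ <;> grind
  · rcases hpl with ⟨-, h⟩ | ⟨rfl | rfl, -⟩ <;> grind

theorem mem_marked {a : TwinLetter ι × Kind} (ha : a ∈ K.marked e d) :
    (a.1 ∈ e ∨ a.1 = t₁) ∨ (a.1 ∈ d ∨ a.1 = t₂) ∨
      ∃ i, (i ∈ K.M₁ ∨ i ∈ K.M₂) ∧ a.1 ∈ [z i, s i] := by
  have hm₁ (i) := K.perm₁.mem_iff (a := i)
  have hm₂ (i) := K.perm₂.mem_iff (a := i)
  simp only [List.mem_append] at hm₁ hm₂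
  simp only [marked, List.mem_append, List.mem_cons] at ha
  grind (splits := 20) [→ exists_of_mem_pre, → exists_of_mem_post, → exists_of_mem_mid,
    → fst_mem_of_mem_mark, mem_restrict]

theorem paired_marked (he : IsOrder [x₁, y₁] e) (hd : IsOrder [x₂, y₂] d) :
    Paired (K.marked e d) := by
  obtain ⟨p, hp⟩ := List.exists_mem_of_ne_nil e he.ne_nil
  obtain ⟨q, hq⟩ := List.exists_mem_of_ne_nil d hd.ne_nil
  intro a ha
  have het : t₁ ∉ e := fun h => by simpa using he.subset h
  have hdt : t₂ ∉ d := fun h => by simpa using hd.subset h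
  rcases mem_marked ha with (h | h) | (h | h) | ⟨i, hi, h⟩
  · exact ⟨_, _, by grind, List.mem_cons_self, filter_marked_t he hd (.inl ⟨h, rfl⟩)⟩
  · exact ⟨p, t₁, by grind, by simp [h], filter_marked_t he hd (.inl ⟨hp, rfl⟩)⟩
  · exact ⟨_, _, by grind, List.mem_cons_self, filter_marked_t he hd (.inr ⟨h, rfl⟩)⟩
  · exact ⟨q, t₂, by grind, by simp [h], filter_marked_t he hd (.inr ⟨hq, rfl⟩)⟩
  · exact ⟨z i, s i, by simp, h, filter_marked_z he.subset hd.subset hi⟩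

end Layout

end Layout

section Chain

open TwinLetter Kind

/-- The pairs of marked letters that may be adjacent in a word in which no second occurrences are
adjacent, and `e` and `d` are the only factors consisting of two first occurrences. -/
def Adjacent {β : Type*} (e d : List β) (a b : β × Kind) : Prop :=
  (a.2 = snd → b.2 ≠ snd) ∧ (a.2 = fst → b.2 = fst → [a.1, b.1] = e ∨ [a.1, b.1] = d)

variable {ι : Type*} {e d : List (TwinLetter ι)}

theorem isChain_append_of_kind {β : Type*} {e d : List β} {V W : List (β × Kind)} {k : Kind}
    (hV : V.IsChain (Adjacent e d)) (hW : W.IsChain (Adjacent e d))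
    (hlast : ∀ a ∈ V.getLast?, a.2 = k) (hhead : ∀ b ∈ W.head?, b.2 = k → k = lin) :
    (V ++ W).IsChain (Adjacent e d) := by
  refine hV.append hW fun a ha b hb => ?_
  have := hlast a ha
  have := hhead b hb
  grind [Adjacent]

theorem isChain_pre (A : List ι) : (pre A).IsChain (Adjacent e d) := by
  induction A with
  | nil => exact .nil
  | cons i A ih =>
    exact isChain_append_of_kind (V := [(z i, fst), (s i, lin)]) (k := lin)
      (by simp [Adjacent]) ih (by simp) (by simp)

theorem isChain_post (D : List ι) : (post D).IsChain (Adjacent e d) := by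
  induction D with
  | nil => exact .nil
  | cons i D ih =>
    exact isChain_append_of_kind (V := [(s i, lin), (z i, snd)]) (k := snd)
      (by simp [Adjacent]) ih (by simp) (by cases D <;> simp)

theorem isChain_mid [DecidableEq ι] {D M : List ι} (hM : M.IsChain fun i j => i ∈ D ↔ j ∉ D) :
    (mid D M).IsChain (Adjacent e d) := by
  rw [mid, List.isChain_map]
  exact hM.imp fun i j hij => by grind [Adjacent]

theorem isChain_mark_snd {f : List (TwinLetter ι)} (hf : f.length ≤ 1) :
    (mark snd f).IsChain (Adjacent e d) := by
  rcases f with _ | ⟨a, _ | ⟨b, f⟩⟩ <;> simp_all [mark]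

theorem isChain_mark_fst {f : List (TwinLetter ι)} (hf : f.length ≤ 2) (hfe : f = e ∨ f = d) :
    (mark fst f).IsChain (Adjacent e d) := by
  rcases f with _ | ⟨a, _ | ⟨b, _ | ⟨c, f⟩⟩⟩ <;> simp_all [mark, Adjacent]

theorem eq_of_mem_getLast?_mark {k : Kind} {f : List (TwinLetter ι)} :
    ∀ a ∈ (mark k f).getLast?, a.2 = k := by
  rcases f.eq_nil_or_concat with rfl | ⟨f, p, rfl⟩ <;> simp [mark]

theorem eq_lin_of_mem_getLast?_pre {A : List ι} : ∀ a ∈ (pre A).getLast?, a.2 = lin := by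
  rcases A.eq_nil_or_concat with rfl | ⟨A, i, rfl⟩ <;> simp [pre]

theorem eq_snd_of_mem_getLast?_post {D : List ι} : ∀ a ∈ (post D).getLast?, a.2 = snd := by
  rcases D.eq_nil_or_concat with rfl | ⟨D, i, rfl⟩ <;> simp [post]

theorem eq_lin_of_mem_head?_post {D : List ι} {k : Kind} :
    ∀ b ∈ (post D).head?, b.2 = k → k = lin := by
  cases D <;> simp [post, eq_comm]

theorem ne_fst_of_mem_head?_mark_snd {f : List (TwinLetter ι)} :
    ∀ b ∈ (mark snd f).head?, b.2 = fst → fst = lin := by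
  cases f <;> simp [mark]

theorem forall_mem_head?_append {β : Type*} {V W : List β} {P : β → Prop}
    (hV : ∀ b ∈ V.head?, P b) (hW : ∀ b ∈ W.head?, P b) : ∀ b ∈ (V ++ W).head?, P b := by
  cases V
  · exact hW
  · exact hV

theorem IsOrder.length_le {β : Type*} {k e : List β} (h : IsOrder k e) : e.length ≤ k.length :=
  (h.nodup.subperm h.subset).length_le

variable [DecidableEq ι]

theorem IsOrder.length_restrict_le {β : Type*} [DecidableEq β] {k e : List β} (he : IsOrder k e)
    (p : β) : (restrict [p] e).length ≤ 1 :=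
  ((he.nodup.filter _).subperm fun _ ha => (mem_restrict.mp ha).2).length_le

namespace Layout

variable {K : Layout ι}

theorem isChain_marked (he : IsOrder [x₁, y₁] e) (hd : IsOrder [x₂, y₂] d) :
    (K.marked e d).IsChain (Adjacent e d) := by
  obtain ⟨q, hq⟩ := Option.ne_none_iff_exists'.mp (mt List.head?_eq_none_iff.mp hd.ne_nil)
  obtain ⟨i₁, hi₁, hiD₁⟩ := K.head₁
  obtain ⟨i₂, hi₂, hiD₂⟩ := K.head₂
  have hmid₁ : ∀ a ∈ (mid K.D₁ K.M₁).getLast?, a.2 = fst := by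
    obtain ⟨j, hj, hjD⟩ := K.last₁
    simp_all [mid]
  have hmid₂ : ∀ a ∈ (mid K.D₂ K.M₂).getLast?, a.2 = fst := by
    obtain ⟨j, hj, hjD⟩ := K.last₂
    simp_all [mid]
  have hpre {A : List ι} {W : List (TwinLetter ι × Kind)} (hW : W.IsChain (Adjacent e d)) :=
    isChain_append_of_kind (isChain_pre A) hW eq_lin_of_mem_getLast?_pre (by simp)
  have hcons {a} {W : List (TwinLetter ι × Kind)} (hW : W.IsChain (Adjacent e d))
      (ha : a.2 = lin) :=
    isChain_append_of_kind (V := [a]) (.singleton a) hW (by simpa) (by simp)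
  have hsnd {p k f} {W : List (TwinLetter ι × Kind)} (hf : IsOrder k f)
      (hW : W.IsChain (Adjacent e d)) :=
    isChain_append_of_kind (isChain_mark_snd (hf.length_restrict_le p)) hW eq_of_mem_getLast?_mark
  have hd_mark : ∀ W, ∀ b ∈ (mark fst d ++ W).head?, b.2 = snd → snd = lin := by simp [mark, hq]
  refine hpre <| hpre <| isChain_append_of_kind (isChain_mark_fst he.length_le (.inl rfl)) (hcons
    (hpre <| hsnd he (isChain_append_of_kind (isChain_mark_fst hd.length_le (.inr rfl))
    (isChain_append_of_kind (isChain_mid K.isChain₁) (hsnd he (isChain_append_of_kind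
    (isChain_post _) (hcons (hpre <| hsnd hd (isChain_append_of_kind (isChain_mid K.isChain₂)
    (hsnd hd (isChain_post _) ?_) hmid₂ ?_) ?_) rfl) eq_snd_of_mem_getLast?_post ?_) ?_) hmid₁ ?_)
    eq_of_mem_getLast?_mark ?_) (hd_mark _)) rfl) eq_of_mem_getLast?_mark ?_
  · exact eq_lin_of_mem_head?_post
  · exact forall_mem_head?_append ne_fst_of_mem_head?_mark_snd eq_lin_of_mem_head?_post
  · simp_all [mid]
  · simp
  · exact forall_mem_head?_append eq_lin_of_mem_head?_post (by simp)
  · exact forall_mem_head?_append ne_fst_of_mem_head?_mark_snd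
      (forall_mem_head?_append eq_lin_of_mem_head?_post (by simp))
  · simp_all [mid]
  · simp

end Layout

end Chain

/-! ### Swapping two adjacent first occurrences -/

/-- No two adjacent letters of `w` have both been read before, and `e` and `d` are the only factors
consisting of two letters that are both read again afterwards. -/
structure Sparse {β : Type*} (e d w : List β) : Prop where
  snd : ∀ A r s D, w = A ++ r :: s :: D → ¬(r ∈ A ∧ s ∈ A)
  fst : ∀ A r s D, w = A ++ r :: s :: D → r ∈ D → s ∈ D → [r, s] = e ∨ [r, s] = d

/-- A word with a gap: two letters and the pieces of a word around their four occurrences, except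
for the order of the two first occurrences, which are adjacent. -/
structure Frame (β : Type*) where
  (before between gap after : List β)
  (fst snd : β)
  ne : fst ≠ snd
  between_ne_nil : between ≠ []
  gap_ne_nil : gap ≠ []
  fst_notMem : fst ∉ before ++ (between ++ gap ++ after)
  snd_notMem : snd ∉ before ++ (between ++ gap ++ after)

namespace Frame

variable {β γ : Type*} (F : Frame β)

/-- The word obtained by filling the frame with `e`, one of the orders of `fst` and `snd`. -/
def word (e : List β) : List β :=
  F.before ++ (e ++ (F.between ++ F.fst :: (F.gap ++ F.snd :: F.after)))

variable {F} {G : Frame γ} {ψ : β → List γ} {a b : List γ} {e₀ e₁ : List β} {e : List γ}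

theorem restrict_word [DecidableEq β] (he : e₀.Perm [F.fst, F.snd]) :
    restrict [F.fst, F.snd] (F.word e₀) = e₀ ++ [F.fst, F.snd] := by
  have hnil {L : List β} (hL : L ⊆ F.before ++ (F.between ++ F.gap ++ F.after)) :
      restrict [F.fst, F.snd] L = [] :=
    restrict_eq_nil_iff.mpr (by simpa using ⟨fun h => F.fst_notMem (hL h),
      fun h => F.snd_notMem (hL h)⟩)
  have hre : restrict [F.fst, F.snd] e₀ = e₀ := restrict_eq_self he.subset
  simp only [word, restrict_append, restrict_cons, hre]
  rw [hnil (L := F.before), hnil (L := F.between), hnil (L := F.gap), hnil (L := F.after)]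
  · simp
  all_goals grind

theorem flatMap_word_congr (h : e₁.flatMap ψ = e₀.flatMap ψ) :
    (F.word e₁).flatMap ψ = (F.word e₀).flatMap ψ := by
  simp [word, h]

theorem exists_eq_word [DecidableEq β] {v : List β}
    (h₁ : v.filter (· != F.fst) = (F.word [F.fst, F.snd]).filter (· != F.fst))
    (h₂ : v.filter (· != F.snd) = (F.word [F.fst, F.snd]).filter (· != F.snd)) :
    ∃ e : List β, e.Perm [F.fst, F.snd] ∧ v = F.word e := by
  have hne := F.ne
  have hfst := F.fst_notMem
  have hsnd := F.snd_notMem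
  have hfilter {p : β} {L : List β} (hp : p ∉ L) : L.filter (· != p) = L :=
    List.filter_eq_self.mpr fun a ha => by grind
  simp only [List.mem_append, not_or] at hfst hsnd
  simp only [word, List.filter_append, List.filter_cons, hfilter hfst.1, hfilter hfst.2.1.1,
    hfilter hfst.2.1.2, hfilter hfst.2.2] at h₁
  simp only [word, List.filter_append, List.filter_cons, hfilter hsnd.1, hfilter hsnd.2.1.1,
    hfilter hsnd.2.1.2, hfilter hsnd.2.2] at h₂
  rcases eq_or_eq_of_filter_ne hne F.between_ne_nil F.gap_ne_nil F.fst_notMem F.snd_notMem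
    (by simpa [hne.symm] using h₁) (by simpa [hne] using h₂) with h | h
  · exact ⟨_, .refl _, h⟩
  · exact ⟨_, .swap .., h⟩

/-- The substitution `ψ`, followed by multiplication by `a` and `b` from the two sides, maps the
pieces of the frame `F` to those of the frame `G`. -/
structure Maps (F : Frame β) (G : Frame γ) (ψ : β → List γ) (a b : List γ) : Prop where
  before : a ++ F.before.flatMap ψ = G.before
  between : F.between.flatMap ψ = G.between
  gap : F.gap.flatMap ψ = G.gap
  after : F.after.flatMap ψ ++ b = G.after
  fst : ψ F.fst = [G.fst]
  snd : ψ F.snd = [G.snd]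

theorem Maps.append_word (h : F.Maps G ψ a b) (e : List β) :
    a ++ (F.word e).flatMap ψ ++ b = G.word (e.flatMap ψ) := by
  simp [word, h.fst, h.snd, ← h.before, ← h.between, ← h.gap, ← h.after]

theorem Maps.exists_of_mem_gap {r : γ} (h : F.Maps G ψ a b) (hr : r ∈ G.gap) :
    ∃ q ∈ F.gap, r ∈ ψ q ∧ (q ∈ F.before → r ∈ G.before) ∧ (q ∈ F.between → r ∈ G.between) ∧
      (q ∈ F.after → r ∈ G.after) := by
  obtain ⟨q, hq, hrq⟩ := List.mem_flatMap.mp (h.gap ▸ hr)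
  have hmem {L : List β} (hL : q ∈ L) : r ∈ L.flatMap ψ := List.mem_flatMap.mpr ⟨q, hL, hrq⟩
  exact ⟨q, hq, hrq, fun hq => h.before ▸ List.mem_append_right _ (hmem hq),
    fun hq => h.between ▸ hmem hq, fun hq => h.after ▸ List.mem_append_left _ (hmem hq)⟩

theorem append_cons_inj_of_notMem_left {p : γ} {X Y X' Y' : List γ} (hX : p ∉ X) (hX' : p ∉ X')
    (h : X ++ p :: Y = X' ++ p :: Y') : X = X' ∧ Y = Y' := by
  rcases List.append_eq_append_iff.mp h with ⟨_ | ⟨q, c⟩, rfl, h⟩ | ⟨_ | ⟨q, c⟩, rfl, h⟩ <;>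
    simp_all

theorem eq_of_append_eq_append {p q u v : γ} {X Y Z T X' Y' Z' T' : List γ}
    (he : e.Perm [p, q]) (huv : [u, v].Perm [p, q]) (hpq : p ≠ q)
    (hp : p ∉ X' ++ (Y' ++ Z' ++ T')) (hq : q ∉ X' ++ (Y' ++ Z' ++ T'))
    (h : X ++ (e ++ (Y ++ u :: (Z ++ v :: T))) = X' ++ (e ++ (Y' ++ p :: (Z' ++ q :: T')))) :
    X = X' ∧ Y = Y' ∧ u = p ∧ Z = Z' ∧ v = q ∧ T = T' := by
  classical
  have hr (L : List γ) (hp : p ∉ L) (hq : q ∉ L) : restrict [p, q] L = [] :=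
    restrict_eq_nil_iff.mpr (by simp [hp, hq])
  have hu : u ∈ [p, q] := huv.subset (by simp)
  have hv : v ∈ [p, q] := huv.subset (by simp)
  have hp' : p ∈ [p, q] := by simp
  have hq' : q ∈ [p, q] := by simp
  have hre : restrict [p, q] e = e := restrict_eq_self he.subset
  have hR := congrArg (restrict [p, q]) h
  simp only [List.mem_append, not_or] at hp hq
  simp only [restrict_append, restrict_cons, hre, hr _ hp.1 hq.1, hr _ hp.2.1.1 hq.2.1.1,
    hr _ hp.2.1.2 hq.2.1.2, hr _ hp.2.2 hq.2.2, if_pos hu, if_pos hv,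
    if_pos hp', if_pos hq', List.nil_append] at hR
  have hlen := congrArg List.length hR
  simp only [List.length_append, List.length_cons, List.length_nil] at hlen
  have hnil {L : List γ} (hL : (restrict [p, q] L).length = 0) : p ∉ L ∧ q ∉ L := by
    simpa [restrict_eq_nil_iff] using hL
  have hX := hnil (L := X) (by omega)
  have hY := hnil (L := Y) (by omega)
  have hZ := hnil (L := Z) (by omega)
  have hT := hnil (L := T) (by omega)
  simp only [hr _ hX.1 hX.2, hr _ hY.1 hY.2, hr _ hZ.1 hZ.2, hr _ hT.1 hT.2, List.nil_append,
    List.append_cancel_left_eq, List.cons.injEq, and_true] at hR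
  obtain ⟨rfl, rfl⟩ := hR
  obtain ⟨r, e, rfl⟩ := List.exists_cons_of_length_pos
    (he.length_eq.symm ▸ Nat.two_pos : 0 < e.length)
  have hr' : r = u ∨ r = v := by simpa using he.subset List.mem_cons_self
  obtain ⟨rfl, h₁⟩ := append_cons_inj_of_notMem_left (by grind) (by grind) h
  obtain ⟨rfl, h₂⟩ := append_cons_inj_of_notMem_left hY.1 hp.2.1.1 (List.append_cancel_left h₁)
  obtain ⟨rfl, rfl⟩ := append_cons_inj_of_notMem_left hZ.2 hq.2.1.2 h₂
  exact ⟨rfl, rfl, rfl, rfl, rfl, rfl⟩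

theorem maps_of_append_word (he : e.Perm [G.fst, G.snd])
    (he₀ : e₀.Perm [F.fst, F.snd]) (hψ : e₀.flatMap ψ = e) (hfst : (ψ F.fst).length = 1)
    (hsnd : (ψ F.snd).length = 1) (h : a ++ (F.word e₀).flatMap ψ ++ b = G.word e) :
    F.Maps G ψ a b := by
  obtain ⟨u, hu⟩ := List.length_eq_one_iff.mp hfst
  obtain ⟨v, hv⟩ := List.length_eq_one_iff.mp hsnd
  have huv : [u, v].Perm [G.fst, G.snd] := by
    simpa [hψ, hu, hv] using (he₀.flatMap_right ψ).symm.trans (hψ ▸ he)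
  obtain ⟨hbefore, hbetween, rfl, hgap, rfl, hafter⟩ :=
    eq_of_append_eq_append (X := a ++ F.before.flatMap ψ) (Y := F.between.flatMap ψ)
      (Z := F.gap.flatMap ψ) (T := F.after.flatMap ψ ++ b) he huv G.ne G.fst_notMem G.snd_notMem
      (by simpa [word, hψ, hu, hv] using h)
  exact ⟨hbefore, hbetween, hgap, hafter, hu, hv⟩

end Frame

section Sparse

variable {β γ : Type*} {F : Frame β} {ψ : β → List γ} {a b e d w : List γ} {e₀ : List β}

theorem Sparse.length_le_one_of_mem {A D : List β} {p : β} (hw : Sparse e d w)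
    (h : a ++ (A ++ p :: D).flatMap ψ ++ b = w) (hp : p ∈ A) : (ψ p).length ≤ 1 := by
  have hA : ∀ r ∈ ψ p, r ∈ a ++ A.flatMap ψ := fun r hr => by
    simp only [List.mem_append, List.mem_flatMap]
    exact .inr ⟨p, hp, hr⟩
  rcases hψ : ψ p with _ | ⟨r, _ | ⟨s, L⟩⟩
  · exact Nat.zero_le 1
  · exact le_rfl
  · exact absurd ⟨hA r (by simp [hψ]), hA s (by simp [hψ])⟩
      (hw.snd _ r s (L ++ D.flatMap ψ ++ b) (by simp [← h, hψ]))

theorem Sparse.flatMap_eq_of_append_word (hw : Sparse e d w) (he₀ : e₀.Perm [F.fst, F.snd])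
    (h : a ++ (F.word e₀).flatMap ψ ++ b = w) :
    (∀ e₁ : List β, e₁.Perm [F.fst, F.snd] → e₁.flatMap ψ = e₀.flatMap ψ) ∨
      (ψ F.fst).length = 1 ∧ (ψ F.snd).length = 1 ∧
        (e₀.flatMap ψ = e ∨ e₀.flatMap ψ = d) := by
  have hlen {A D : List β} {p : β} (hF : F.word e₀ = A ++ p :: D) (hp : p ∈ A) :
      (ψ p).length ≤ 1 := hw.length_le_one_of_mem (hF ▸ h) hp
  have hfst : (ψ F.fst).length ≤ 1 := hlen (A := F.before ++ (e₀ ++ F.between))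
    (by simp [Frame.word]; rfl) (by simp [he₀.mem_iff])
  have hsnd : (ψ F.snd).length ≤ 1 := hlen
    (A := F.before ++ (e₀ ++ (F.between ++ F.fst :: F.gap))) (by simp [Frame.word]; rfl)
    (by simp [he₀.mem_iff])
  refine or_iff_not_imp_left.mpr fun hne => ?_
  obtain ⟨hfst, hsnd⟩ : (ψ F.fst).length = 1 ∧ (ψ F.snd).length = 1 := by
    rw [Nat.le_one_iff_eq_zero_or_eq_one, List.length_eq_zero_iff] at hfst hsnd
    rw [List.perm_pair] at he₀
    by_contra hlen
    refine hne fun e₁ he₁ => ?_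
    rw [List.perm_pair] at he₁
    rcases hfst with h | h <;> rcases hsnd with h' | h' <;> rcases he₀ with rfl | rfl <;>
      rcases he₁ with rfl | rfl <;> simp_all
  refine ⟨hfst, hsnd, ?_⟩
  obtain ⟨r, s, hrs⟩ : ∃ r s, e₀.flatMap ψ = [r, s] := by
    rw [← List.length_eq_two, (he₀.flatMap_right ψ).length_eq]
    simp [hfst, hsnd]
  have hmem : ∀ u ∈ [r, s], u ∈ F.between.flatMap ψ ++ (ψ F.fst ++ (F.gap.flatMap ψ ++
      (ψ F.snd ++ (F.after.flatMap ψ ++ b)))) := fun u hu => by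
    have : u ∈ ψ F.fst ∨ u ∈ ψ F.snd := by
      simpa using (he₀.flatMap_right ψ).subset (hrs ▸ hu)
    grind
  rw [hrs]
  exact hw.fst (a ++ F.before.flatMap ψ) r s _ (by simp [← h, Frame.word, hrs])
    (hmem r (by simp)) (hmem s (by simp))

end Sparse

section Swap

open TwinLetter Kind

theorem Paired.sparse {β : Type*} [DecidableEq β] {W : List (β × Kind)} {e d : List β}
    (hW : Paired W) (hchain : W.IsChain (Adjacent e d)) : Sparse e d (W.map Prod.fst) := by
  have hsplit {A r s D} (h : W.map Prod.fst = A ++ r :: s :: D) : ∃ i j,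
      Occurs A (s :: D) r i ∧ Occurs (A ++ [r]) D s j ∧ Adjacent e d (r, i) (s, j) := by
    obtain ⟨A, R, rfl, rfl, hR⟩ := List.map_eq_append_iff.mp h
    obtain ⟨⟨r, i⟩, R, rfl, rfl, hR'⟩ := List.map_eq_cons_iff.mp hR
    obtain ⟨⟨s, j⟩, D, rfl, rfl, rfl⟩ := List.map_eq_cons_iff.mp hR'
    have hs := hW.occurs (List.append_cons A (r, i) ((s, j) :: D))
    rw [List.map_append] at hs
    exact ⟨i, j, hW.occurs rfl, hs, (List.isChain_append_cons_cons.mp hchain).2.1⟩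
  refine ⟨fun A r s D h => ?_, fun A r s D h hr hs => ?_⟩ <;>
    obtain ⟨i, j, hri, hsj, hij⟩ := hsplit h <;> clear hsplit hW hchain h
  · rintro ⟨hr, hs⟩
    rcases hri <;> rcases hsj <;> grind [Adjacent]
  · rcases hri <;> rcases hsj <;> grind [Adjacent]

variable {ι : Type*} [DecidableEq ι] {e d : List (TwinLetter ι)} {i : ι}

theorem restrict_singleton_of_perm {β : Type*} [DecidableEq β] {p q : β} {e : List β}
    (hpq : p ≠ q) (he : e.Perm [p, q]) : restrict [p] e = [p] ∧ restrict [q] e = [q] := by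
  rcases List.perm_pair.mp he with rfl | rfl <;> simp [restrict_cons, hpq, hpq.symm]

theorem isOrder_of_perm {β : Type*} {p q : β} {e : List β} (hpq : p ≠ q) (he : e.Perm [p, q]) :
    IsOrder [p, q] e :=
  ⟨he.nodup_iff.mpr (by simpa), fun h => by simp [h] at he, he.subset⟩

namespace Layout

variable (K : Layout ι)

/-- The frame in which `x₁` and `y₁` first occur. -/
def frame₁ (hd : d ⊆ [x₂, y₂]) : Frame (TwinLetter ι) where
  before := (pre K.A₁ ++ pre K.A₂).map Prod.fst
  between := t₁ :: (pre K.C₁).map Prod.fst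
  gap := d ++ (mid K.D₁ K.M₁).map Prod.fst
  after := (post K.D₁ ++ (t₂, lin) :: (pre K.C₂ ++ (mark snd (restrict [x₂] d) ++
    (mid K.D₂ K.M₂ ++ (mark snd (restrict [y₂] d) ++ post K.D₂))))).map Prod.fst
  fst := x₁
  snd := y₁
  ne := by simp
  between_ne_nil := by simp
  gap_ne_nil := by
    obtain ⟨i, hi, -⟩ := K.head₁
    have := List.mem_of_mem_head? hi
    simp [mid, List.ne_nil_of_mem this]
  fst_notMem := by
    have : x₁ ∉ d := fun h => by simpa using hd h
    simpa [pre, mid, post, mark, mem_restrict] using this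
  snd_notMem := by
    have : y₁ ∉ d := fun h => by simpa using hd h
    simpa [pre, mid, post, mark, mem_restrict] using this

/-- The frame in which `x₂` and `y₂` first occur. -/
def frame₂ (he : e ⊆ [x₁, y₁]) : Frame (TwinLetter ι) where
  before := (pre K.A₁ ++ (pre K.A₂ ++ (mark fst e ++ (t₁, lin) :: (pre K.C₁ ++
    mark snd (restrict [x₁] e))))).map Prod.fst
  between := (mid K.D₁ K.M₁ ++ (mark snd (restrict [y₁] e) ++ (post K.D₁ ++ (t₂, lin) ::
    pre K.C₂))).map Prod.fst
  gap := (mid K.D₂ K.M₂).map Prod.fst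
  after := (post K.D₂).map Prod.fst
  fst := x₂
  snd := y₂
  ne := by simp
  between_ne_nil := by simp
  gap_ne_nil := by
    obtain ⟨i, hi, -⟩ := K.head₂
    have := List.mem_of_mem_head? hi
    simp [mid, List.ne_nil_of_mem this]
  fst_notMem := by
    have : x₂ ∉ e := fun h => by simpa using he h
    simpa [pre, mid, post, mark, mem_restrict] using this
  snd_notMem := by
    have : y₂ ∉ e := fun h => by simpa using he h
    simpa [pre, mid, post, mark, mem_restrict] using this

variable {K}

theorem frame₁_word {hd : d ⊆ [x₂, y₂]} (he : e.Perm [x₁, y₁]) :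
    (K.frame₁ hd).word e = K.word e d := by
  obtain ⟨hx, hy⟩ := restrict_singleton_of_perm (by simp) he
  simp [frame₁, Frame.word, word, marked, hx, hy, mark, Function.comp_def]

theorem frame₂_word {he : e ⊆ [x₁, y₁]} (hd : d.Perm [x₂, y₂]) :
    (K.frame₂ he).word d = K.word e d := by
  obtain ⟨hx, hy⟩ := restrict_singleton_of_perm (by simp) hd
  simp [frame₂, Frame.word, word, marked, hx, hy, mark, Function.comp_def]

theorem sparse_word (he : IsOrder [x₁, y₁] e) (hd : IsOrder [x₂, y₂] d) :
    Sparse e d (K.word e d) :=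
  (paired_marked he hd).sparse (isChain_marked he hd)

end Layout

theorem length_flatMap_le {α β : Type*} {J : List β} {f : β → List α}
    (hf : ∀ j ∈ J, (f j).length ≤ 1) : (J.flatMap f).length ≤ J.length := by
  simpa [List.length_flatMap] using
    List.sum_le_card_nsmul (J.map fun j => (f j).length) 1 (by simpa using hf)

theorem Sparse.length_le_one_of_count {β γ : Type*} [DecidableEq β] {ψ : β → List γ}
    {a b e d w : List γ} {v : List β} {p : β} (hw : Sparse e d w)
    (h : a ++ v.flatMap ψ ++ b = w) (hp : v.count p = 2) : (ψ p).length ≤ 1 := by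
  obtain ⟨A, R, rfl, hA⟩ := List.eq_append_cons_of_mem (List.count_pos_iff.mp (hp ▸ Nat.two_pos))
  have hR : p ∈ R := List.count_pos_iff.mp (by simp [List.count_eq_zero.mpr hA] at hp; omega)
  obtain ⟨R, D, rfl⟩ := List.append_of_mem hR
  exact hw.length_le_one_of_mem (A := A ++ p :: R) (by simpa using h) (by simp)

variable {ι : Type*} [DecidableEq ι]

namespace Layout

variable {K : Layout ι} {e d e₀ e₁ d₀ d₁ : List (TwinLetter ι)}
  {ψ : TwinLetter ι → List (TwinLetter ι)} {a b : List (TwinLetter ι)}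

theorem count_word {p : TwinLetter ι} (he : IsOrder [x₁, y₁] e) (hd : IsOrder [x₂, y₂] d)
    (hp : p ∈ e ∨ p ∈ d ∨ ∃ i, (i ∈ K.M₁ ∨ i ∈ K.M₂) ∧ p = z i) : (K.word e d).count p = 2 := by
  obtain ⟨l, hl, h⟩ : ∃ l ≠ p, (K.marked e d).filter (·.1 ∈ [p, l]) =
      [(p, fst), (l, lin), (p, snd)] := by
    rcases hp with hp | hp | ⟨i, hi, rfl⟩
    · exact ⟨t₁, by rintro rfl; simpa using he.subset hp, filter_marked_t he hd (.inl ⟨hp, rfl⟩)⟩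
    · exact ⟨t₂, by rintro rfl; simpa using hd.subset hp, filter_marked_t he hd (.inr ⟨hp, rfl⟩)⟩
    · exact ⟨s i, by simp, filter_marked_z he.subset hd.subset hi⟩
  rw [← count_restrict (k := [p, l]) List.mem_cons_self, word, restrict_map_fst, h]
  simp [hl]

theorem length_C_le_of_maps {hd : d.Perm [x₂, y₂]} {he : e ⊆ [x₁, y₁]}
    (hψ : ∀ i ∈ K.C₁, (ψ (z i)).length ≤ 1)
    (h : (K.frame₁ hd.subset).Maps (K.frame₂ he) ψ a b) : K.C₂.length ≤ K.C₁.length := by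
  have hN := K.nodup
  have hN₂ := K.perm₂.nodup_iff.mp hN.of_append_right
  have hm₁ (i) := K.perm₁.mem_iff (a := i)
  have hm₂ (i) := K.perm₂.mem_iff (a := i)
  obtain ⟨hx, hy⟩ := restrict_singleton_of_perm (by simp) hd
  simp only [List.nodup_append, List.mem_append] at hN hN₂ hm₁ hm₂
  suffices K.C₂.map z ⊆ K.C₁.flatMap (ψ ∘ z) by
    simpa using ((hN₂.1.2.1.map fun i j h => by simpa using h).subperm this).length_le.trans
      (length_flatMap_le hψ)
  intro r hr
  obtain ⟨i, hi, rfl⟩ := List.mem_map.mp hr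
  have hze : z i ∉ e := fun h => by simpa using he h
  obtain ⟨q, hq, hiq, hbefore, -, hafter⟩ := h.exists_of_mem_gap (r := z i) <|
    z_mem_map_mid.mpr (by grind)
  have hgap : q ∈ d ∨ ∃ j ∈ K.M₁, z j = q := by simpa [frame₁, mid] using hq
  rcases hgap with hq | ⟨j, hj, rfl⟩
  · have := hafter (by simp [frame₁, mark, hx, hy]; grind [hd.subset hq])
    grind [frame₂, z_mem_map_post]
  · have := (hm₁ j).mp hj
    simp only [frame₁, frame₂, List.map_append, List.map_cons, List.mem_append, List.mem_cons,
      z_mem_map_pre, z_mem_map_mid, z_mem_map_post, map_mark, mem_restrict] at hbefore hafter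
    grind

theorem length_A_le_of_maps {hd : d ⊆ [x₂, y₂]} {he : e ⊆ [x₁, y₁]}
    (hψ : ∀ i ∈ K.A₂, (ψ (z i)).length ≤ 1)
    (h : (K.frame₂ he).Maps (K.frame₁ hd) ψ a b) : K.A₁.length ≤ K.A₂.length := by
  have hN := K.nodup
  have hN₁ := K.perm₁.nodup_iff.mp hN.of_append_left
  have hm₁ (i) := K.perm₁.mem_iff (a := i)
  have hm₂ (i) := K.perm₂.mem_iff (a := i)
  simp only [List.nodup_append, List.mem_append] at hN hN₁ hm₁ hm₂
  suffices K.A₁.map z ⊆ K.A₂.flatMap (ψ ∘ z) by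
    simpa using ((hN₁.1.1.map fun i j h => by simpa using h).subperm this).length_le.trans
      (length_flatMap_le hψ)
  intro r hr
  obtain ⟨i, hi, rfl⟩ := List.mem_map.mp hr
  have hzd : z i ∉ d := fun h => by simpa using hd h
  obtain ⟨q, hq, hiq, -, hbetween, hafter⟩ := h.exists_of_mem_gap (r := z i) <|
    by simp only [frame₁, List.mem_append, z_mem_map_mid]; grind
  have hgap : ∃ j ∈ K.M₂, z j = q := by simpa [frame₂, mid] using hq
  obtain ⟨j, hj, rfl⟩ := hgap
  have := (hm₂ j).mp hj
  simp only [frame₁, frame₂, List.map_append, List.map_cons, List.mem_append, List.mem_cons,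
    z_mem_map_pre, z_mem_map_mid, z_mem_map_post, map_mark, mem_restrict] at hbetween hafter
  grind

theorem flatMap_eq_of_maps_frame₁ {hd₀ : d₀ ⊆ [x₂, y₂]} {hd : d ⊆ [x₂, y₂]}
    (hψd : ∀ p ∈ d₀, (ψ p).length ≤ 1) (hψ : ∀ i ∈ K.M₁, (ψ (z i)).length ≤ 1)
    (hlen : d₀.length = d.length) (h : (K.frame₁ hd₀).Maps (K.frame₁ hd) ψ a b) :
    d₀.flatMap ψ = d := by
  have hgap : d₀.flatMap ψ ++ (K.M₁.map z).flatMap ψ = d ++ K.M₁.map z := by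
    simpa [frame₁, mid, Function.comp_def] using h.gap
  have hle₁ := length_flatMap_le hψd
  have hle₂ := length_flatMap_le (J := K.M₁.map z) (by simpa using hψ)
  have heq := congrArg List.length hgap
  simp only [List.length_append] at heq
  exact (List.append_inj hgap (by omega)).1

theorem restrict_word₂ (he : e ⊆ [x₁, y₁]) (hd : d.Perm [x₂, y₂]) :
    restrict [x₂, y₂] (K.word e d) = d ++ [x₂, y₂] :=
  frame₂_word (he := he) hd ▸ (K.frame₂ he).restrict_word hd

theorem eq_of_flatMap_eq (he₀ : e₀ ⊆ [x₁, y₁]) (he : e ⊆ [x₁, y₁]) (hd₀ : d₀.Perm [x₂, y₂])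
    (hd : d.Perm [x₂, y₂]) (hψ : ∀ p ∈ d₀, (ψ p).length ≤ 1) (hψd : d₀.flatMap ψ = d)
    (h : a ++ (K.word e₀ d₀).flatMap ψ ++ b = K.word e d) : d = d₀ := by
  have hsub : ((d₀ ++ [x₂, y₂]).flatMap ψ).Sublist (K.word e d) := by
    refine .trans ?_ (h ▸ (List.sublist_append_right ..).trans (List.sublist_append_left ..))
    exact restrict_word₂ (K := K) he₀ hd₀ ▸ List.filter_sublist.flatMap ψ
  have hmem : ψ x₂ ++ ψ y₂ ⊆ [x₂, y₂] := fun r hr => hd.subset <| by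
    rw [← hψd, (hd₀.flatMap_right ψ).mem_iff]
    simpa using hr
  have hψxy : ψ x₂ ++ ψ y₂ = [x₂, y₂] := by
    have hlen : (ψ x₂ ++ ψ y₂).length = 2 := by
      simpa [hψd, hd.length_eq] using (hd₀.flatMap_right ψ).length_eq.symm
    refine List.Sublist.eq_of_length ?_ hlen
    have hr' := hsub.filter (· ∈ [x₂, y₂])
    rw [← restrict, ← restrict, restrict_word₂ he hd, List.flatMap_append, hψd, restrict_append,
      restrict_eq_self hd.subset, List.append_sublist_append_left] at hr'
    simpa [restrict_eq_self hmem] using hr'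
  obtain ⟨hx, hy⟩ : ψ x₂ = [x₂] ∧ ψ y₂ = [y₂] := by
    have hlen := congrArg List.length hψxy
    have hlex := hψ x₂ (by simp [hd₀.mem_iff])
    have hley := hψ y₂ (by simp [hd₀.mem_iff])
    simp only [List.length_append, List.length_cons, List.length_nil] at hlen
    exact List.append_inj (s₂ := [x₂]) (t₂ := [y₂]) hψxy (by simp; omega)
  rcases List.perm_pair.mp hd₀ with rfl | rfl <;> simpa [hx, hy] using hψd.symm

theorem append_flatMap_word_swap₁ (he₀ : e₀.Perm [x₁, y₁]) (he₁ : e₁.Perm [x₁, y₁])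
    (he : e.Perm [x₁, y₁]) (hd₀ : d₀.Perm [x₂, y₂]) (hd : d.Perm [x₂, y₂])
    (h : a ++ (K.word e₀ d₀).flatMap ψ ++ b = K.word e d) :
    a ++ (K.word e₁ d₀).flatMap ψ ++ b = K.word e d ∨
      d = d₀ ∧ ∃ e', e'.Perm [x₁, y₁] ∧ a ++ (K.word e₁ d₀).flatMap ψ ++ b = K.word e' d := by
  have hsparse := K.sparse_word (isOrder_of_perm (by simp) he) (isOrder_of_perm (by simp) hd)
  have hψ {p} hp := hsparse.length_le_one_of_count (p := p) h
    (count_word (isOrder_of_perm (by simp) he₀) (isOrder_of_perm (by simp) hd₀) hp)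
  rw [← frame₁_word (hd := hd₀.subset) he₁]
  have h' := h
  rw [← frame₁_word (hd := hd₀.subset) he₀] at h'
  rcases hsparse.flatMap_eq_of_append_word he₀ h' with heq | ⟨hx, hy, heψ | hdψ⟩
  · rw [Frame.flatMap_word_congr (heq e₁ he₁)]
    exact .inl h'
  · right
    have hmaps := Frame.maps_of_append_word (G := K.frame₁ hd.subset) he he₀ heψ hx hy
      (h'.trans (frame₁_word he).symm)
    have hψd₀ : ∀ p ∈ d₀, (ψ p).length ≤ 1 := fun p hp => hψ (.inr (.inl hp))
    have hψM : ∀ i ∈ K.M₁, (ψ (z i)).length ≤ 1 := fun i hi => hψ (.inr (.inr ⟨i, .inl hi, rfl⟩))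
    have hdψ := flatMap_eq_of_maps_frame₁ hψd₀ hψM (hd₀.trans hd.symm).length_eq hmaps
    have he' : (e₁.flatMap ψ).Perm [x₁, y₁] :=
      ((he₁.trans he₀.symm).flatMap_right ψ).trans (heψ ▸ he)
    exact ⟨eq_of_flatMap_eq he₀.subset he.subset hd₀ hd hψd₀ hdψ h, e₁.flatMap ψ, he',
      (hmaps.append_word e₁).trans (frame₁_word he')⟩
  · have hmaps := Frame.maps_of_append_word (G := K.frame₂ he.subset) hd he₀ hdψ hx hy
      (h'.trans (frame₂_word hd).symm)
    have hψC : ∀ i ∈ K.C₁, (ψ (z i)).length ≤ 1 := fun i hi =>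
      hψ (.inr (.inr ⟨i, .inl (K.perm₁.mem_iff.mpr (by simp [hi])), rfl⟩))
    exact absurd (length_C_le_of_maps (hd := hd₀) hψC hmaps) K.length_C.not_ge

theorem append_flatMap_word_swap₂ (he₀ : e₀.Perm [x₁, y₁]) (he : e.Perm [x₁, y₁])
    (hd₀ : d₀.Perm [x₂, y₂]) (hd₁ : d₁.Perm [x₂, y₂]) (hd : d.Perm [x₂, y₂])
    (h : a ++ (K.word e₀ d₀).flatMap ψ ++ b = K.word e d) :
    ∃ d', d'.Perm [x₂, y₂] ∧ a ++ (K.word e₀ d₁).flatMap ψ ++ b = K.word e d' := by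
  have hsparse := K.sparse_word (isOrder_of_perm (by simp) he) (isOrder_of_perm (by simp) hd)
  have hψ {p} hp := hsparse.length_le_one_of_count (p := p) h
    (count_word (isOrder_of_perm (by simp) he₀) (isOrder_of_perm (by simp) hd₀) hp)
  rw [← frame₂_word (he := he₀.subset) hd₁]
  have h' := h
  rw [← frame₂_word (he := he₀.subset) hd₀] at h'
  rcases hsparse.flatMap_eq_of_append_word hd₀ h' with heq | ⟨hx, hy, heψ | hdψ⟩
  · rw [Frame.flatMap_word_congr (heq d₁ hd₁)]
    exact ⟨d, hd, h'⟩
  · have hmaps := Frame.maps_of_append_word (G := K.frame₁ hd.subset) he hd₀ heψ hx hy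
      (h'.trans (frame₁_word he).symm)
    have hψA : ∀ i ∈ K.A₂, (ψ (z i)).length ≤ 1 := fun i hi =>
      hψ (.inr (.inr ⟨i, .inr (K.perm₂.mem_iff.mpr (by simp [hi])), rfl⟩))
    exact absurd (length_A_le_of_maps hψA hmaps) K.length_A.not_ge
  · have hmaps := Frame.maps_of_append_word (G := K.frame₂ he.subset) hd hd₀ hdψ hx hy
      (h'.trans (frame₂_word hd).symm)
    have hd' : (d₁.flatMap ψ).Perm [x₂, y₂] :=
      ((hd₁.trans hd₀.symm).flatMap_right ψ).trans (hdψ ▸ hd)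
    exact ⟨d₁.flatMap ψ, hd', (hmaps.append_word d₁).trans (frame₂_word hd')⟩

end Layout

end Swap

/-! ### Identities with a word of a layout -/

section Classify

open TwinLetter Kind

namespace Layout

variable {α ι : Type*} [DecidableEq ι] {K : Layout ι} {c : List α} {e d v : List (TwinLetter ι)}
  {p q : TwinLetter ι}

theorem filter_word (hp : p ∈ [x₁, y₁, x₂, y₂]) :
    (K.word e d).filter (· != p) = K.word (e.filter (· != p)) (d.filter (· != p)) := by
  have hp' : p = x₁ ∨ p = y₁ ∨ p = x₂ ∨ p = y₂ := by simpa using hp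
  have hr (k w : List (TwinLetter ι)) :
      (restrict k w).filter (· != p) = restrict k (w.filter (· != p)) := by
    simp only [restrict, List.filter_filter, Bool.and_comm]
  have hpre (A : List ι) : ((pre A).map Prod.fst).filter (· != p) = (pre A).map Prod.fst :=
    List.filter_eq_self.mpr (by grind [pre])
  have hpost (A : List ι) : ((post A).map Prod.fst).filter (· != p) = (post A).map Prod.fst :=
    List.filter_eq_self.mpr (by grind [post])
  have hmid (D M : List ι) : ((mid D M).map Prod.fst).filter (· != p) = (mid D M).map Prod.fst :=
    List.filter_eq_self.mpr (by grind [mid])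
  have ht₁ : (t₁ != p) = true := by grind
  have ht₂ : (t₂ != p) = true := by grind
  simp only [word, marked, List.map_append, List.map_cons, List.filter_append, List.filter_cons,
    hpre, hpost, hmid, map_mark, hr, ht₁, ht₂, if_true]

theorem eq_word_of_factorEq_singleton (hc : Detects c) (hp : p ∈ [x₁, y₁]) (hq : q ∈ [x₂, y₂])
    (h : FactorEq c (K.word [p] [q]) v) : v = K.word [p] [q] := by
  have he : IsOrder [x₁, y₁] [p] := ⟨by simp, by simp, by simpa using hp⟩
  have hd : IsOrder [x₂, y₂] [q] := ⟨by simp, by simp, by simpa using hq⟩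
  refine h.eq hc (paired_marked he hd) ((isChain_marked he hd).imp fun a b hab => ⟨?_, hab.1⟩)
  intro ha hb
  simpa using hab.2 ha hb

theorem filter_ne_of_perm {β : Type*} [DecidableEq β] {p q : β} {e : List β} (hpq : p ≠ q)
    (he : e.Perm [p, q]) : e.filter (· != p) = [q] ∧ e.filter (· != q) = [p] := by
  rcases List.perm_pair.mp he with rfl | rfl <;> simp [hpq, hpq.symm]

theorem filter_word₁ (he : e.Perm [x₁, y₁]) (hd : d ⊆ [x₂, y₂]) :
    (K.word e d).filter (· != x₁) = K.word [y₁] d ∧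
      (K.word e d).filter (· != y₁) = K.word [x₁] d := by
  obtain ⟨hx, hy⟩ := filter_ne_of_perm (by simp) he
  have hd' : d.filter (· != x₁) = d ∧ d.filter (· != y₁) = d := by
    constructor <;> refine List.filter_eq_self.mpr fun a ha => ?_ <;> grind [hd ha]
  rw [filter_word (by simp), filter_word (by simp), hx, hy, hd'.1, hd'.2]
  exact ⟨rfl, rfl⟩

theorem filter_word₂ (he : e ⊆ [x₁, y₁]) (hd : d.Perm [x₂, y₂]) :
    (K.word e d).filter (· != x₂) = K.word e [y₂] ∧
      (K.word e d).filter (· != y₂) = K.word e [x₂] := by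
  obtain ⟨hx, hy⟩ := filter_ne_of_perm (by simp) hd
  have he' : e.filter (· != x₂) = e ∧ e.filter (· != y₂) = e := by
    constructor <;> refine List.filter_eq_self.mpr fun a ha => ?_ <;> grind [he ha]
  rw [filter_word (by simp), filter_word (by simp), hx, hy, he'.1, he'.2]
  exact ⟨rfl, rfl⟩

theorem exists_eq_word_of_factorEq_singleton (hc : Detects c) (hp : p ∈ [x₁, y₁])
    (hd : d.Perm [x₂, y₂]) (h : FactorEq c (K.word [p] d) v) :
    ∃ d', d'.Perm [x₂, y₂] ∧ v = K.word [p] d' := by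
  have hpe : [p] ⊆ [x₁, y₁] := by simpa using hp
  obtain ⟨hx, hy⟩ := filter_word₂ (K := K) hpe hd
  obtain ⟨hx', hy'⟩ := filter_word₂ (K := K) hpe (.refl [x₂, y₂])
  have hvx := h.filter (· != x₂)
  have hvy := h.filter (· != y₂)
  rw [hx] at hvx
  rw [hy] at hvy
  rw [← frame₂_word (he := hpe) (.refl _)] at hx' hy'
  obtain ⟨d', hd', rfl⟩ := (K.frame₂ hpe).exists_eq_word
    ((eq_word_of_factorEq_singleton hc hp (by simp) hvx).trans hx'.symm)
    ((eq_word_of_factorEq_singleton hc hp (by simp) hvy).trans hy'.symm)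
  exact ⟨d', hd', frame₂_word hd'⟩

theorem exists_eq_word_of_factorEq (hc : Detects c) (he : e.Perm [x₁, y₁]) (hd : d.Perm [x₂, y₂])
    (h : FactorEq c (K.word e d) v) :
    ∃ e' d', e'.Perm [x₁, y₁] ∧ d'.Perm [x₂, y₂] ∧ v = K.word e' d' := by
  obtain ⟨hx, hy⟩ := filter_word₁ (K := K) he hd.subset
  have hvx := h.filter (· != x₁)
  have hvy := h.filter (· != y₁)
  rw [hx] at hvx
  rw [hy] at hvy
  obtain ⟨d', hd', hvx⟩ := exists_eq_word_of_factorEq_singleton hc (by simp) hd hvx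
  obtain ⟨d'', hd'', hvy⟩ := exists_eq_word_of_factorEq_singleton hc (by simp) hd hvy
  obtain rfl : d'' = d' := by
    have hrestrict (p : TwinLetter ι) (hp : p ∉ [x₂, y₂]) :
        restrict [x₂, y₂] (v.filter (· != p)) = restrict [x₂, y₂] v := by
      rw [restrict, restrict, List.filter_filter]
      exact List.filter_congr fun a _ => by grind
    have hr := (hrestrict x₁ (by simp)).trans (hrestrict y₁ (by simp)).symm
    rw [hvx, hvy, restrict_word₂ (by simp) hd', restrict_word₂ (by simp) hd''] at hr
    exact (List.append_cancel_right hr).symm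
  obtain ⟨hx', hy'⟩ := filter_word₁ (K := K) (.refl [x₁, y₁]) hd'.subset
  rw [← frame₁_word (hd := hd'.subset) (.refl _)] at hx' hy'
  obtain ⟨e', he', rfl⟩ := (K.frame₁ hd'.subset).exists_eq_word (hvx.trans hx'.symm)
    (hvy.trans hy'.symm)
  exact ⟨e', d'', he', hd', frame₁_word he'⟩

end Layout

end Classify

/-! ### The two copies of `cWord` -/

section Alternating

variable {N p q : ℕ}

/-- The values of a permutation, listed in the order of the arguments. -/
def values (ρ : Equiv.Perm (Fin N)) : List ℕ := List.ofFn fun i => (ρ i : ℕ)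

theorem values_perm (ρ : Equiv.Perm (Fin N)) : (values ρ).Perm (List.range' 0 N) := by
  have hnodup : (values ρ).Nodup := List.nodup_ofFn.mpr (Fin.val_injective.comp ρ.injective)
  rw [List.perm_ext_iff_of_nodup hnodup List.nodup_range']
  intro i
  rw [values, List.mem_ofFn, List.mem_range'_1]
  exact ⟨fun ⟨j, hj⟩ => by omega, fun hi => ⟨ρ.symm ⟨i, by omega⟩, by simp⟩⟩

theorem IsAlternatingPerm.isChain_values {ρ : Equiv.Perm (Fin (p + q))}
    (hρ : IsAlternatingPerm p q ρ) :
    (values ρ).IsChain fun i j => i ∈ List.range' p q ↔ j ∉ List.range' p q := by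
  rw [List.isChain_iff_getElem]
  intro i hi
  have hi' : i + 1 < p + q := by simpa [values] using hi
  have := hρ ⟨i, by omega⟩ ⟨i + 1, hi'⟩ rfl
  simp only [values, List.getElem_ofFn, List.mem_range'_1]
  omega

theorem countP_values (ρ : Equiv.Perm (Fin (p + q))) :
    (values ρ).countP (· ∈ List.range' p q) = q := by
  rw [(values_perm ρ).countP_eq, ← List.range'_append_1, List.countP_append,
    List.countP_eq_zero.mpr (by grind), List.countP_eq_length.mpr (by simp)]
  simp

theorem exists_mem_head?_of_isChain {α : Type*} [DecidableEq α] {k l : List α}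
    (hl : l.IsChain fun a b => a ∈ k ↔ b ∉ k) (hlen : l.length = p + (p + 1))
    (hcount : l.countP (· ∈ k) = p + 1) : ∃ a ∈ l.head?, a ∈ k := by
  have hchain : (l.map (decide <| · ∈ k)).IsChain (· ≠ ·) := by
    rw [List.isChain_map]
    exact hl.imp fun a b h => by grind
  have h := hchain.two_mul_count_bool_eq_ite true
  rw [List.count, List.countP_map, List.length_map, hlen] at h
  rcases l with _ | ⟨a, l⟩
  · simp at hlen
  · refine ⟨a, rfl, ?_⟩
    by_contra ha
    simp only [Function.comp_def, beq_true, hcount, List.map_cons, List.head?_cons, ha,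
      decide_false, Option.some_beq_some, beq_false, Bool.not_true, Bool.false_eq_true,
      if_false] at h
    split_ifs at h <;> omega

theorem IsAlternatingPerm.exists_mem_head? {ρ : Equiv.Perm (Fin (p + (p + 1)))}
    (hρ : IsAlternatingPerm p (p + 1) ρ) : ∃ i ∈ (values ρ).head?, i ∈ List.range' p (p + 1) :=
  exists_mem_head?_of_isChain hρ.isChain_values List.length_ofFn (countP_values ρ)

theorem IsAlternatingPerm.exists_mem_getLast? {ρ : Equiv.Perm (Fin (p + (p + 1)))}
    (hρ : IsAlternatingPerm p (p + 1) ρ) :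
    ∃ i ∈ (values ρ).getLast?, i ∈ List.range' p (p + 1) := by
  rw [← List.head?_reverse]
  refine exists_mem_head?_of_isChain ?_ (List.length_reverse.trans List.length_ofFn) ?_
  · rw [List.isChain_reverse]
    exact hρ.isChain_values.imp fun i j h => by grind
  · rw [List.countP_reverse, countP_values]

end Alternating

section Twin

/-- Two copies of `ℕ`, indexing the letters of two copies of `cWord`, and the indices of three
additional letters. -/
inductive Index : Type
  | copy₁ : ℕ → Index
  | copy₂ : ℕ → Index
  | early : Index
  | central : Index
  | late : Index
  deriving DecidableEq, Countable

open Index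

variable {n m : ℕ} {ρ : Equiv.Perm (Fin (n + m + (n + m + 1)))}

theorem values_perm_append (ρ : Equiv.Perm (Fin (n + m + (n + m + 1)))) :
    (values ρ).Perm (List.range' 0 n ++ List.range' n m ++ List.range' (n + m) (n + m + 1)) := by
  have h₁ := List.range'_append_1 (s := 0) (m := n) (n := m)
  have h₂ := List.range'_append_1 (s := 0) (m := n + m) (n := n + m + 1)
  rw [Nat.zero_add] at h₁ h₂
  rw [h₁, h₂]
  exact values_perm ρ

/-- Two copies of the scheme of `cWord n m (n + m + 1) ρ`. The additional letters make the part
before the first `xy` longer in the first copy, and the part between the first `xy` and the second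
`x` longer in the second one, so that no substitution maps one copy to the other one. -/
def twinLayout (n m : ℕ) (ρ : Equiv.Perm (Fin (n + m + (n + m + 1))))
    (hρ : IsAlternatingPerm (n + m) (n + m + 1) ρ) : Layout Index where
  A₁ := (List.range' 0 n).map copy₁ ++ [early]
  C₁ := (List.range' n m).map copy₁
  D₁ := (List.range' (n + m) (n + m + 1)).map copy₁
  M₁ := early :: (values ρ).map copy₁
  A₂ := (List.range' 0 n).map copy₂
  C₂ := central :: (List.range' n m).map copy₂
  D₂ := (List.range' (n + m) (n + m + 1)).map copy₂ ++ [late]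
  M₂ := late :: central :: (values ρ).map copy₂
  perm₁ := by
    have h := ((values_perm_append ρ).map copy₁).cons early
    simp only [List.map_append, List.append_assoc] at h ⊢
    exact h.trans List.perm_middle.symm
  perm₂ := by
    have h := (((values_perm_append ρ).map copy₂).cons central).cons late
    simp only [List.map_append, List.append_assoc] at h ⊢
    grind
  nodup := by
    have h := (values_perm ρ).nodup_iff.mpr List.nodup_range'
    have h₁ := h.map (f := copy₁) fun _ _ => Index.copy₁.inj
    have h₂ := h.map (f := copy₂) fun _ _ => Index.copy₂.inj
    grind
  isChain₁ := by
    obtain ⟨i, hi, h⟩ := hρ.exists_mem_head?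
    rw [List.isChain_cons, List.isChain_map]
    exact ⟨by simp_all, hρ.isChain_values.imp fun i j h => by simpa using h⟩
  isChain₂ := by
    obtain ⟨i, hi, h⟩ := hρ.exists_mem_head?
    rw [List.isChain_cons, List.isChain_cons, List.isChain_map]
    exact ⟨by simp, by simp_all, hρ.isChain_values.imp fun i j h => by simpa using h⟩
  head₁ := by simp
  head₂ := by simp
  last₁ := by
    obtain ⟨i, hi, h⟩ := hρ.exists_mem_getLast?
    exact ⟨copy₁ i, by simp_all [List.getLast?_cons], by simpa using h⟩
  last₂ := by
    obtain ⟨i, hi, h⟩ := hρ.exists_mem_getLast?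
    exact ⟨copy₂ i, by simp_all [List.getLast?_cons], by simpa using h⟩
  length_A := by simp
  length_C := by simp

end Twin

section Detects

open Letter

/-- The word of the form `cWord` with arbitrary index lists, in which `e` replaces the first
occurrences of `x` and `y`. -/
def scheme (A C D M : List ℕ) (e : List Letter) : List Letter :=
  A.flatMap (fun i => [z i, s i]) ++ (e ++ t :: (C.flatMap (fun i => [z i, s i]) ++ x ::
    (M.map z ++ y :: D.flatMap fun i => [s i, z i])))

theorem toList_cWord (n m k : ℕ) (τ : Equiv.Perm (Fin (n + m + k))) :
    (cWord n m k τ).toList = scheme (List.range' 0 n) (List.range' n m) (List.range' (n + m) k)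
      (values τ) [x, y] := by
  simp [cWord, scheme, values, List.map_ofFn, Function.comp_def]

variable {A C D D' M : List ℕ} {i : ℕ}

theorem isoterm_scheme_snd_fst (hC : i ∉ C) (hM : i ∉ M) (hD : i ∉ D) :
    Isoterm (scheme A C (D ++ i :: D') (i :: M) [x, y]) [0, 1, 0, 2, 3, 2] := by
  refine isoterm_of_leftInverse (List.cons_ne_nil _ _)
    ([[x], y :: t :: C.flatMap (fun i => [z i, s i]), [z i],
      M.map z ++ y :: (D.flatMap (fun i => [s i, z i]) ++ [s i])].getD · [])
    (fun | x => [0] | y => [] | t => [1] | z j => if j = i then [2] else []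
         | s j => if j = i then [3] else []) ?_ ?_
  · have hC' : ∀ j ∈ C, j ≠ i := fun j hj h => hC (h ▸ hj)
    have hM' : ∀ j ∈ M, j ≠ i := fun j hj h => hM (h ▸ hj)
    have hD' : ∀ j ∈ D, j ≠ i := fun j hj h => hD (h ▸ hj)
    simp +contextual [List.flatMap_assoc, List.flatMap_map, hC', hM', hD', List.flatMap_congr,
      flatMap_const_nil]
  · exact ⟨A.flatMap fun i => [z i, s i], D'.flatMap fun i => [s i, z i], by simp [scheme]⟩

theorem isoterm_scheme_fst_snd (hC : i ∉ C) (hM : i ∉ M) (hD : i ∉ D) :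
    Isoterm (scheme A C (D ++ i :: D') (M ++ [i]) [x, y]) [2, 3, 0, 2, 1, 0] := by
  refine isoterm_of_leftInverse (List.cons_ne_nil _ _)
    ([[z i], D.flatMap (fun i => [s i, z i]) ++ [s i], [y],
      t :: (C.flatMap (fun i => [z i, s i]) ++ x :: M.map z)].getD · [])
    (fun | x => [] | y => [2] | t => [3] | z j => if j = i then [0] else []
         | s j => if j = i then [1] else []) ?_ ?_
  · have hC' : ∀ j ∈ C, j ≠ i := fun j hj h => hC (h ▸ hj)
    have hM' : ∀ j ∈ M, j ≠ i := fun j hj h => hM (h ▸ hj)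
    have hD' : ∀ j ∈ D, j ≠ i := fun j hj h => hD (h ▸ hj)
    simp +contextual [List.flatMap_assoc, List.flatMap_map, hC', hM', hD', List.flatMap_congr]
  · exact ⟨A.flatMap (fun i => [z i, s i]) ++ [x], D'.flatMap fun i => [s i, z i],
      by simp [scheme]⟩

variable {n m : ℕ} {ρ : Equiv.Perm (Fin (n + m + (n + m + 1)))}

theorem detects_cWord (hρ : IsAlternatingPerm (n + m) (n + m + 1) ρ) :
    Detects (cWord n m (n + m + 1) ρ).toList := by
  have hnodup : (values ρ).Nodup := (values_perm ρ).nodup_iff.mpr List.nodup_range'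
  have hC {i} (hi : i ∈ List.range' (n + m) (n + m + 1)) : i ∉ List.range' n m := by
    rw [List.mem_range'_1] at hi ⊢
    omega
  rw [toList_cWord]
  constructor
  · obtain ⟨i, hi, hiD⟩ := hρ.exists_mem_head?
    obtain ⟨M, hM⟩ := List.head?_eq_some_iff.mp hi
    obtain ⟨D, D', hD, hiD'⟩ := List.eq_append_cons_of_mem hiD
    rw [hM, List.nodup_cons] at hnodup
    rw [hM, hD]
    exact isoterm_scheme_snd_fst (hC hiD) hnodup.1 hiD'
  · obtain ⟨i, hi, hiD⟩ := hρ.exists_mem_getLast?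
    obtain ⟨M, hM⟩ := List.getLast?_eq_some_iff.mp hi
    obtain ⟨D, D', hD, hiD'⟩ := List.eq_append_cons_of_mem hiD
    rw [hM, ← List.concat_eq_append, List.nodup_concat] at hnodup
    rw [hM, hD]
    exact isoterm_scheme_fst_snd (hC hiD) hnodup.1 hiD'

end Detects

section Projections

open TwinLetter Index

variable {n m : ℕ} {ρ : Equiv.Perm (Fin (n + m + (n + m + 1)))}
  {hρ : IsAlternatingPerm (n + m) (n + m + 1) ρ} {e d e' d' : List (TwinLetter Index)}

/-- The substitution that keeps the first copy of `cWord` and deletes all other letters. -/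
def proj₁ : TwinLetter Index → List Letter
  | x₁ => [.x] | y₁ => [.y] | t₁ => [.t]
  | z (copy₁ i) => [.z i] | s (copy₁ i) => [.s i]
  | _ => []

/-- The substitution that keeps the second copy of `cWord` and deletes all other letters. -/
def proj₂ : TwinLetter Index → List Letter
  | x₂ => [.x] | y₂ => [.y] | t₂ => [.t]
  | z (copy₂ i) => [.z i] | s (copy₂ i) => [.s i]
  | _ => []

theorem flatMap_proj₁_word (he : e.Perm [x₁, y₁]) (hd : d.Perm [x₂, y₂]) :
    ((twinLayout n m ρ hρ).word e d).flatMap proj₁ =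
      scheme (List.range' 0 n) (List.range' n m) (List.range' (n + m) (n + m + 1)) (values ρ)
        (e.flatMap proj₁) := by
  rw [List.perm_pair] at he hd
  rcases he with rfl | rfl <;> rcases hd with rfl | rfl <;>
    simp [Layout.word, Layout.marked, twinLayout, scheme, pre, post, mid, mark, restrict, proj₁,
      List.flatMap_assoc, List.flatMap_map, List.map_flatMap, flatMap_const_nil,
      ← List.map_eq_flatMap]

theorem flatMap_proj₂_word (he : e.Perm [x₁, y₁]) (hd : d.Perm [x₂, y₂]) :
    ((twinLayout n m ρ hρ).word e d).flatMap proj₂ =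
      scheme (List.range' 0 n) (List.range' n m) (List.range' (n + m) (n + m + 1)) (values ρ)
        (d.flatMap proj₂) := by
  rw [List.perm_pair] at he hd
  rcases he with rfl | rfl <;> rcases hd with rfl | rfl <;>
    simp [Layout.word, Layout.marked, twinLayout, scheme, pre, post, mid, mark, restrict, proj₂,
      List.flatMap_assoc, List.flatMap_map, List.map_flatMap, flatMap_const_nil,
      ← List.map_eq_flatMap]

theorem eq_of_factorEq_word₁ (he' : e'.Perm [x₁, y₁]) (hd : d.Perm [x₂, y₂])
    (hd' : d'.Perm [x₂, y₂])
    (h : FactorEq (cWord n m (n + m + 1) ρ).toList ((twinLayout n m ρ hρ).word [x₁, y₁] d)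
      ((twinLayout n m ρ hρ).word e' d')) : e' = [x₁, y₁] := by
  rw [toList_cWord] at h
  have h' := h proj₁ (flatMap_proj₁_word (.refl _) hd ▸ List.infix_refl _)
  rw [flatMap_proj₁_word he' hd', flatMap_proj₁_word (.refl _) hd, scheme, scheme,
    List.append_cancel_left_eq, List.append_cancel_right_eq] at h'
  rw [List.perm_pair] at he'
  rcases he' with rfl | rfl
  · rfl
  · simp [proj₁] at h'

theorem eq_of_factorEq_word₂ (he : e.Perm [x₁, y₁]) (he' : e'.Perm [x₁, y₁])
    (hd' : d'.Perm [x₂, y₂])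
    (h : FactorEq (cWord n m (n + m + 1) ρ).toList ((twinLayout n m ρ hρ).word e [x₂, y₂])
      ((twinLayout n m ρ hρ).word e' d')) : d' = [x₂, y₂] := by
  rw [toList_cWord] at h
  have h' := h proj₂ (flatMap_proj₂_word he (.refl _) ▸ List.infix_refl _)
  rw [flatMap_proj₂_word he' hd', flatMap_proj₂_word he (.refl _), scheme, scheme,
    List.append_cancel_left_eq, List.append_cancel_right_eq] at h'
  rw [List.perm_pair] at hd'
  rcases hd' with rfl | rfl
  · rfl
  · simp [proj₂] at h'

end Projections

/-! ### Syntactic monoids -/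

section Syntactic

variable {β γ : Type*}

/-- The identity `u ≈ v` between words over an arbitrary alphabet holds in the monoid `M`. -/
def Holds (M : Type*) [Monoid M] (u v : List β) : Prop :=
  ∀ φ : β → M, (u.map φ).prod = (v.map φ).prod

theorem satisfies_iff_holds {M : MonCat.{0}} {e : Word × Word} :
    Satisfies M e ↔ Holds M e.1.toList e.2.toList := by
  simp only [Satisfies, Holds, FreeMonoid.lift_apply]

theorem holds_map_iff {M : Type*} [Monoid M] {g : β → γ} (hg : g.Injective) {u v : List β} :
    Holds M (u.map g) (v.map g) ↔ Holds M u v := by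
  simp only [Holds, List.map_map]
  refine ⟨fun h φ => ?_, fun h φ => h _⟩
  simpa only [Function.extend_comp hg] using h (Function.extend g φ 1)

theorem prod_map_ofList (u : List β) (ψ : β → List γ) :
    (u.map fun b => FreeMonoid.ofList (ψ b)).prod = FreeMonoid.ofList (u.flatMap ψ) := by
  induction u with
  | nil => rfl
  | cons b u ih =>
    rw [List.map_cons, List.prod_cons, ih, List.flatMap_cons, FreeMonoid.ofList_append]

/-- The syntactic congruence of a language. -/
def syntacticCon (L : Set (List γ)) : Con (FreeMonoid γ) where
  r u v := ∀ a b : FreeMonoid γ, (a * u * b).toList ∈ L ↔ (a * v * b).toList ∈ L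
  iseqv := ⟨fun _ _ _ => Iff.rfl, fun h a b => (h a b).symm, fun h k a b => (h a b).trans (k a b)⟩
  mul' {u v u' v'} h k a b := by
    simpa only [mul_assoc] using (h a (u' * b)).trans (by simpa only [mul_assoc] using k (a * v) b)

/-- The syntactic monoid of a language. -/
def syntactic {γ : Type} (L : Set (List γ)) : MonCat.{0} := MonCat.of (syntacticCon L).Quotient

theorem holds_syntactic_iff {γ : Type} {L : Set (List γ)} {u v : List β} :
    Holds (syntactic L) u v ↔ ∀ (ψ : β → List γ) (a b : List γ),
      a ++ u.flatMap ψ ++ b ∈ L ↔ a ++ v.flatMap ψ ++ b ∈ L := by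
  have hprod (ψ : β → List γ) (w : List β) :
      (w.map fun b => (syntacticCon L).mk' (FreeMonoid.ofList (ψ b))).prod =
        (syntacticCon L).mk' (FreeMonoid.ofList (w.flatMap ψ)) := by
    rw [← prod_map_ofList, map_list_prod, List.map_map]
    rfl
  have hcon (ψ : β → List γ) :
      (u.map fun b => (syntacticCon L).mk' (FreeMonoid.ofList (ψ b))).prod =
        (v.map fun b => (syntacticCon L).mk' (FreeMonoid.ofList (ψ b))).prod ↔
      ∀ a b : List γ, a ++ u.flatMap ψ ++ b ∈ L ↔ a ++ v.flatMap ψ ++ b ∈ L := by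
    rw [hprod, hprod]
    exact (syntacticCon L).eq
  refine ⟨fun h ψ => (hcon ψ).mp (h _), fun h φ => ?_⟩
  obtain ⟨ψ, rfl⟩ : ∃ ψ : β → List γ, φ = fun b => (syntacticCon L).mk' (FreeMonoid.ofList (ψ b)) :=
    ⟨fun b => (φ b).out.toList, funext fun b => (Quotient.out_eq (φ b)).symm⟩
  exact (hcon ψ).mpr (h ψ)

theorem not_holds_syntactic_singleton {β : Type} {u v : List β} (h : u ≠ v) :
    ¬Holds (syntactic {u}) u v := by
  intro hu
  have huv := holds_syntactic_iff.mp hu (fun b => [b]) [] []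
  simp only [List.nil_append, List.append_nil, List.flatMap_singleton'] at huv
  exact h (huv.mp rfl).symm

end Syntactic

namespace FactorMonoid

variable {W : Set Word} {u v : Word}

/-- The homomorphism from words to the factor monoid that is the identity on factors. -/
noncomputable def ofWordHom (W : Set Word) : Word →* FactorMonoid W where
  toFun := ofWord W
  map_one' := dif_pos (Or.inl rfl)
  map_mul' u v := by
    by_cases h : IsFactor W u
    · rw [show ofWord W u = some ⟨u, h⟩ from dif_pos h]
      exact (mul_ofWord ⟨u, h⟩ v).symm
    · rw [show ofWord W u = none from dif_neg h,
        show ofWord W (u * v) = none from dif_neg fun huv => h huv.left]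
      rfl

theorem eq_of_ofWordHom_eq (hu : IsFactor W u) (h : ofWordHom W u = ofWordHom W v) : u = v := by
  have hu' : ofWordHom W u = some ⟨u, hu⟩ := dif_pos hu
  by_cases hv : IsFactor W v
  · have hv' : ofWordHom W v = some ⟨v, hv⟩ := dif_pos hv
    exact congrArg Subtype.val (Option.some.inj (hu'.symm.trans (h.trans hv')))
  · have hv' : ofWordHom W v = none := dif_neg hv
    exact absurd (hu'.symm.trans (h.trans hv')) (Option.some_ne_none _)

end FactorMonoid

theorem factorEq_of_holds {β : Type*} {c : Word} {u v : List β}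
    (h : Holds (FactorMonoid {c}) u v) : FactorEq c.toList u v := by
  intro φ hφ
  have hprod (w : List β) :
      (w.map fun b => FactorMonoid.ofWordHom {c} (FreeMonoid.ofList (φ b))).prod =
        FactorMonoid.ofWordHom {c} (FreeMonoid.ofList (w.flatMap φ)) := by
    rw [← prod_map_ofList, map_list_prod, List.map_map]
    rfl
  obtain ⟨a, b, hab⟩ := hφ
  have hfactor : IsFactor {c} (FreeMonoid.ofList (u.flatMap φ)) := .inr ⟨c, rfl, a, b, hab⟩
  exact (FactorMonoid.eq_of_ofWordHom_eq hfactor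
    ((hprod u).symm.trans ((h _).trans (hprod v)))).symm

namespace Variety

variable {β : Type} {U V : Variety} {L L₁ L₂ : Set (List β)}

theorem mem_inf {M : MonCat.{0}} : M ∈ (U ⊓ V).carrier ↔ M ∈ U.carrier ∧ M ∈ V.carrier := by
  refine ⟨fun h => ⟨(inf_le_left : U ⊓ V ≤ U) h, (inf_le_right : U ⊓ V ≤ V) h⟩, ?_⟩
  rintro ⟨hU, hV⟩ W (rfl | rfl)
  exacts [hU, hV]

theorem mem_generatedBy {M N : MonCat.{0}} (h : ∀ e, Satisfies M e → Satisfies N e) :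
    N ∈ (generatedBy M).carrier := by
  intro V hV
  obtain ⟨E, hE⟩ := V.equational
  have hM : M ∈ V.carrier := hV
  rw [hE] at hM ⊢
  exact fun e he => h e (hM e he)

theorem syntactic_inter_mem_sup (h₁ : syntactic L₁ ∈ U.carrier) (h₂ : syntactic L₂ ∈ V.carrier) :
    syntactic (L₁ ∩ L₂) ∈ (U ⊔ V).carrier := by
  obtain ⟨E, hE⟩ := (U ⊔ V).equational
  replace h₁ := (le_sup_left : U ≤ U ⊔ V) h₁
  replace h₂ := (le_sup_right : V ≤ U ⊔ V) h₂
  rw [hE] at h₁ h₂ ⊢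
  intro e he
  have h₁ := holds_syntactic_iff.mp (satisfies_iff_holds.mp (h₁ e he))
  have h₂ := holds_syntactic_iff.mp (satisfies_iff_holds.mp (h₂ e he))
  exact satisfies_iff_holds.mpr <| holds_syntactic_iff.mpr fun ψ a b =>
    and_congr (h₁ ψ a b) (h₂ ψ a b)

theorem syntactic_mem_factorVariety {c : Word}
    (h : ∀ u ∈ L, ∀ v, FactorEq c.toList u v → v ∈ L) :
    syntactic L ∈ (factorVariety {c}).carrier := by
  refine mem_generatedBy fun e he => satisfies_iff_holds.mpr <| holds_syntactic_iff.mpr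
    fun ψ a b => ?_
  rw [satisfies_iff_holds] at he
  exact ⟨fun hu => h _ hu _ (((factorEq_of_holds he).flatMap ψ).append a b),
    fun hv => h _ hv _ (((factorEq_of_holds fun φ => (he φ).symm).flatMap ψ).append a b)⟩

section Identity

variable [Countable β]

/-- The variety defined by the identity `u ≈ v` between words over a countable alphabet. -/
def ofIdentity (u v : List β) : Variety where
  carrier := {M | Holds M u v}
  equational := by
    obtain ⟨g, hg⟩ := exists_injective_nat β
    have hgz : (Letter.z ∘ g).Injective := fun _ _ h => hg (Letter.z.inj h)
    refine ⟨{(.ofList (u.map (Letter.z ∘ g)), .ofList (v.map (Letter.z ∘ g)))}, ?_⟩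
    ext M
    simp only [models, Set.mem_ofPred_eq, Set.mem_singleton_iff, forall_eq, satisfies_iff_holds,
      FreeMonoid.toList_ofList, holds_map_iff hgz]

variable {w₁ w₂ w₃ w₄ : List β}

theorem inf_ofIdentity_le : ofIdentity w₁ w₃ ⊓ ofIdentity w₂ w₄ ⊓ ofIdentity w₁ w₂ ≤
    ofIdentity w₃ w₄ := by
  intro M hM φ
  obtain ⟨⟨h₁₃, h₂₄⟩, h₁₂⟩ := (mem_inf.trans (and_congr_left' mem_inf)).mp hM
  exact (h₁₃ φ).symm.trans ((h₁₂ φ).trans (h₂₄ φ))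

theorem exists_not_sup_inf_le (h : w₃ ≠ w₄) (hL : L₁ ∩ L₂ = {w₃})
    (hV₁ : syntactic L₁ ∈ V.carrier) (hV₂ : syntactic L₂ ∈ V.carrier)
    (h₁₂ : Holds (syntactic L₁) w₁ w₂) (h₃₄ : Holds (syntactic L₁) w₃ w₄)
    (h₁₃ : Holds (syntactic L₂) w₁ w₃) (h₂₄ : Holds (syntactic L₂) w₂ w₄)
    (hw₃ : Holds (syntactic {w₃}) w₁ w₂) :
    ∃ X Y Z : V.Subvarieties, X ≤ Z ∧ ¬(X ⊔ Y) ⊓ Z ≤ X ⊔ Y ⊓ Z := by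
  let Z := V ⊓ ofIdentity w₁ w₂
  let X := Z ⊓ ofIdentity w₃ w₄
  let Y := V ⊓ (ofIdentity w₁ w₃ ⊓ ofIdentity w₂ w₄)
  have hXZ : X ≤ Z := inf_le_left
  have hZV : Z ≤ V := inf_le_left
  have hYV : Y ≤ V := inf_le_left
  refine ⟨⟨X, hXZ.trans hZV⟩, ⟨Y, hYV⟩, ⟨Z, hZV⟩, hXZ, fun hle =>
    not_holds_syntactic_singleton h ?_⟩
  have hX : syntactic L₁ ∈ X.carrier := mem_inf.mpr ⟨mem_inf.mpr ⟨hV₁, h₁₂⟩, h₃₄⟩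
  have hY : syntactic L₂ ∈ Y.carrier := mem_inf.mpr ⟨hV₂, mem_inf.mpr ⟨h₁₃, h₂₄⟩⟩
  have hXY : syntactic {w₃} ∈ (X ⊔ Y).carrier := hL ▸ syntactic_inter_mem_sup hX hY
  have hle' : (X ⊔ Y) ⊓ Z ≤ X ⊔ Y ⊓ Z := hle
  have hsup : X ⊔ Y ⊓ Z ≤ ofIdentity w₃ w₄ :=
    sup_le inf_le_right ((inf_le_inf inf_le_right inf_le_right).trans inf_ofIdentity_le)
  exact hsup (hle' (mem_inf.mpr ⟨hXY, mem_inf.mpr ⟨sup_le (hXZ.trans hZV) hYV hXY, hw₃⟩⟩))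

end Identity

end Variety

/-! ### The pentagon -/

section Main

open TwinLetter

variable (n m : ℕ) (ρ : Equiv.Perm (Fin (n + m + (n + m + 1))))
  (hρ : IsAlternatingPerm (n + m) (n + m + 1) ρ)

/-- The words of the twin layout whose second pair is in the order `x₂y₂`. -/
def language₁ : Set (List (TwinLetter Index)) :=
  {w | ∃ e, e.Perm [x₁, y₁] ∧ (twinLayout n m ρ hρ).word e [x₂, y₂] = w}

/-- The words of the twin layout whose first pair is in the order `x₁y₁`. -/
def language₂ : Set (List (TwinLetter Index)) :=
  {w | ∃ d, d.Perm [x₂, y₂] ∧ (twinLayout n m ρ hρ).word [x₁, y₁] d = w}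

variable {n m ρ hρ} {e₀ e₁ d₀ d₁ : List (TwinLetter Index)}

theorem syntactic_language₁_mem :
    syntactic (language₁ n m ρ hρ) ∈ (factorVariety {cWord n m (n + m + 1) ρ}).carrier := by
  refine Variety.syntactic_mem_factorVariety ?_
  rintro _ ⟨e, he, rfl⟩ v hv
  obtain ⟨e', d', he', hd', rfl⟩ :=
    Layout.exists_eq_word_of_factorEq (detects_cWord hρ) he (.refl _) hv
  rw [eq_of_factorEq_word₂ he he' hd' hv]
  exact ⟨e', he', rfl⟩

theorem syntactic_language₂_mem :
    syntactic (language₂ n m ρ hρ) ∈ (factorVariety {cWord n m (n + m + 1) ρ}).carrier := by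
  refine Variety.syntactic_mem_factorVariety ?_
  rintro _ ⟨d, hd, rfl⟩ v hv
  obtain ⟨e', d', he', hd', rfl⟩ :=
    Layout.exists_eq_word_of_factorEq (detects_cWord hρ) (.refl _) hd hv
  rw [eq_of_factorEq_word₁ he' hd hd' hv]
  exact ⟨d', hd', rfl⟩

theorem language₁_inter_language₂ : language₁ n m ρ hρ ∩ language₂ n m ρ hρ =
    {(twinLayout n m ρ hρ).word [x₁, y₁] [x₂, y₂]} := by
  ext w
  constructor
  · rintro ⟨⟨e, he, rfl⟩, d, hd, h⟩
    rw [eq_of_factorEq_word₁ he hd (.refl _) fun φ _ => by rw [h]]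
    rfl
  · rintro rfl
    exact ⟨⟨_, .refl _, rfl⟩, _, .refl _, rfl⟩

theorem holds_syntactic_language₁ (he₀ : e₀.Perm [x₁, y₁]) (he₁ : e₁.Perm [x₁, y₁])
    (hd₀ : d₀.Perm [x₂, y₂]) : Holds (syntactic (language₁ n m ρ hρ))
      ((twinLayout n m ρ hρ).word e₀ d₀) ((twinLayout n m ρ hρ).word e₁ d₀) := by
  have hswap {e₀ e₁} (he₀ : e₀.Perm [x₁, y₁]) (he₁ : e₁.Perm [x₁, y₁]) (ψ a b)
      (h : a ++ ((twinLayout n m ρ hρ).word e₀ d₀).flatMap ψ ++ b ∈ language₁ n m ρ hρ) :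
      a ++ ((twinLayout n m ρ hρ).word e₁ d₀).flatMap ψ ++ b ∈ language₁ n m ρ hρ := by
    obtain ⟨e, he, h⟩ := h
    rcases Layout.append_flatMap_word_swap₁ he₀ he₁ he hd₀ (.refl _) h.symm with
      h | ⟨-, e', he', h⟩
    exacts [⟨e, he, h.symm⟩, ⟨e', he', h.symm⟩]
  exact holds_syntactic_iff.mpr fun ψ a b => ⟨hswap he₀ he₁ ψ a b, hswap he₁ he₀ ψ a b⟩

theorem holds_syntactic_language₂ (he₀ : e₀.Perm [x₁, y₁]) (hd₀ : d₀.Perm [x₂, y₂])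
    (hd₁ : d₁.Perm [x₂, y₂]) : Holds (syntactic (language₂ n m ρ hρ))
      ((twinLayout n m ρ hρ).word e₀ d₀) ((twinLayout n m ρ hρ).word e₀ d₁) := by
  have hswap {d₀ d₁} (hd₀ : d₀.Perm [x₂, y₂]) (hd₁ : d₁.Perm [x₂, y₂]) (ψ a b)
      (h : a ++ ((twinLayout n m ρ hρ).word e₀ d₀).flatMap ψ ++ b ∈ language₂ n m ρ hρ) :
      a ++ ((twinLayout n m ρ hρ).word e₀ d₁).flatMap ψ ++ b ∈ language₂ n m ρ hρ := by
    obtain ⟨d, hd, h⟩ := h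
    obtain ⟨d', hd', h⟩ :=
      Layout.append_flatMap_word_swap₂ he₀ (.refl _) hd₀ hd₁ hd h.symm
    exact ⟨d', hd', h.symm⟩
  exact holds_syntactic_iff.mpr fun ψ a b => ⟨hswap hd₀ hd₁ ψ a b, hswap hd₁ hd₀ ψ a b⟩

theorem holds_syntactic_word (he₀ : e₀.Perm [x₁, y₁]) (he₁ : e₁.Perm [x₁, y₁])
    (hd₀ : d₀.Perm [x₂, y₂]) (h : [x₂, y₂] ≠ d₀) :
    Holds (syntactic {(twinLayout n m ρ hρ).word [x₁, y₁] [x₂, y₂]})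
      ((twinLayout n m ρ hρ).word e₀ d₀) ((twinLayout n m ρ hρ).word e₁ d₀) := by
  have hswap {e₀ e₁} (he₀ : e₀.Perm [x₁, y₁]) (he₁ : e₁.Perm [x₁, y₁]) (ψ a b)
      (hw : a ++ ((twinLayout n m ρ hρ).word e₀ d₀).flatMap ψ ++ b =
        (twinLayout n m ρ hρ).word [x₁, y₁] [x₂, y₂]) :
      a ++ ((twinLayout n m ρ hρ).word e₁ d₀).flatMap ψ ++ b =
        (twinLayout n m ρ hρ).word [x₁, y₁] [x₂, y₂] :=
    (Layout.append_flatMap_word_swap₁ he₀ he₁ (.refl _) hd₀ (.refl _) hw).resolve_right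
      fun h' => h h'.1
  exact holds_syntactic_iff.mpr fun ψ a b => ⟨hswap he₀ he₁ ψ a b, hswap he₁ he₀ ψ a b⟩

theorem exists_not_sup_inf_le_cWord (n m : ℕ) (ρ : Equiv.Perm (Fin (n + m + (n + m + 1))))
    (hρ : IsAlternatingPerm (n + m) (n + m + 1) ρ) :
    ∃ X Y Z : (factorVariety {cWord n m (n + m + 1) ρ}).Subvarieties,
      X ≤ Z ∧ ¬(X ⊔ Y) ⊓ Z ≤ X ⊔ Y ⊓ Z := by
  have hxy₁ := List.Perm.refl [(x₁ : TwinLetter Index), y₁]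
  have hyx₁ := List.Perm.swap (x₁ : TwinLetter Index) y₁ []
  have hxy₁₂ := List.Perm.refl [(x₂ : TwinLetter Index), y₂]
  have hyx₁₂ := List.Perm.swap (x₂ : TwinLetter Index) y₂ []
  have hne : (twinLayout n m ρ hρ).word [y₁, x₁] [x₂, y₂] ≠
      (twinLayout n m ρ hρ).word [x₁, y₁] [x₂, y₂] := fun h => by
    have := eq_of_factorEq_word₁ hyx₁ hxy₁₂ hxy₁₂ fun φ _ => by rw [h]
    simp at this
  exact Variety.exists_not_sup_inf_le hne.symm language₁_inter_language₂
    syntactic_language₁_mem syntactic_language₂_mem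
    (holds_syntactic_language₁ hxy₁ hyx₁ hyx₁₂) (holds_syntactic_language₁ hxy₁ hyx₁ hxy₁₂)
    (holds_syntactic_language₂ hxy₁ hyx₁₂ hxy₁₂) (holds_syntactic_language₂ hyx₁ hyx₁₂ hxy₁₂)
    (holds_syntactic_word hxy₁ hyx₁ hyx₁₂ (by decide))

end Main

end MonVar

theorem mainTheorem4 (n m : ℕ) (ρ : Equiv.Perm (Fin (n + m + (n + m + 1))))
    (hρ : MonVar.IsAlternatingPerm (n + m) (n + m + 1) ρ) :
    ¬ IsModularLattice
        (MonVar.factorVariety {MonVar.cWord n m (n + m + 1) ρ}).Subvarieties ∧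
    ¬ ∀ X Y Z : (MonVar.factorVariety {MonVar.cWord n m (n + m + 1) ρ}).Subvarieties,
        X ⊓ (Y ⊔ Z) = (X ⊓ Y) ⊔ (X ⊓ Z) := by
  obtain ⟨X, Y, Z, hXZ, h⟩ := MonVar.exists_not_sup_inf_le_cWord n m ρ hρ
  refine ⟨fun hmod => h (hmod.sup_inf_le_assoc_of_le Y hXZ), fun hdist => h ?_⟩
  rw [inf_comm, hdist Z X Y, inf_eq_right.mpr hXZ, inf_comm Z Y]
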